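/- Let $k$ be a commutative ring, $H$ a bialgebra over $k$, $A$ a left $H$-comodule algebra (an algebra with an algebra map $\rho_A: A\to H\otimes A$, $\rho_A(a)=\sum a_{<-1>}\otimes a_{<0>}$, that is a left $H$-coaction) and $C$ a right $H$-module coalgebra (a coalgebra and right $H$-module with $\Delta(c\cdot h)=\sum c_{(1)}\cdot h_{(1)}\otimes c_{(2)}\cdot h_{(2)}$ and $\varepsilon(c\cdot h)=\varepsilon(c)\varepsilon(h)$), flat as a $k$-module; $\otimes$ and ${\rm Hom}$ are over $k$. Let ${\cal C}={}^C{\cal M}(H)_A$ be the category of Doi-Hopf modules: right $A$-modules and left $C$-comodules $M$ with $\rho_M(ma)=\sum m_{<-1>}\cdot a_{<-1>}\otimes m_{<0>}a_{<0>}$, with $A$-linear $C$-colinear maps. Let $F:{\cal C}\to{\cal M}_A$ forget the coaction and let $G(N)=C\otimes N$ be its right adjoint, with $(c\otimes n)a=\sum c\cdot a_{<-1>}\otimes na_{<0>}$ and $\rho(c\otimes n)=\sum c_{(1)}\otimes c_{(2)}\otimes n$; the unit $1_{\cal C}\to GF$ is the coaction $\rho_M:M\to C\otimes M$, the counit is $c\otimes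 n\mapsto\varepsilon(c)n$. Let $A\#C^*$ be $A\otimes C^*$ with $(a\#c^*)(b\#d^*)=\sum a_{<0>}b\#c^**(a_{<-1>}\cdot d^*)$, where $*$ is convolution and $\langle h\cdot c^*,c\rangle=\langle c^*,c\cdot h\rangle$. Let $\#(C,A)$ be ${\rm Hom}(C,A)$ with $(f\bullet g)(c)=\sum f(c_{(1)})_{<0>}\,g(c_{(2)}\cdot f(c_{(1)})_{<-1>})$, and $i:A\#C^*\to\#(C,A)$ the algebra map $i(a\#c^*)(c)=\langle c^*,c\rangle a$. Through $i$ and $a\mapsto a\#\varepsilon$, ${\rm Hom}(C,A)$ is an $(A,A\#C^*)$-bimodule; in particular $(a\cdot f)(c)=\sum a_{<0>}f(c\cdot a_{<-1>})$ and $(f\cdot a)(c)=f(c)a$. Let $P:{\cal C}\to{\cal M}_{A\#C^*}$ be $P(M)=M$ with $m\cdot(a\#c^*)=\sum\langle c^*,m_{<-1>}\rangle m_{<0>}a$. Then $C\otimes A=PG(A)$, with the left action $b(c\otimes a)=c\otimes ba$, is an $(A,A\#C^*)$-bimodule. Let $T:{\cal M}_A\to{\cal M}_{A\#C^*}$ be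 $N\mapsto N\otimes_A\#(C,A)$ followed by restriction of scalars along $i$, and let $\chi:TF\to P$ be $\chi_M(m\otimes f)=\sum m_{<0>}f(m_{<-1>})$. $F$ is called separable relative to $({\cal M}_{A\#C^*},P,T,\chi)$ if there is a natural transformation $\phi:PG\to T$ with $$\chi_M\circ\phi_{F(M)}\circ P(\rho_M)=1_{P(M)}\quad\hbox{for all } M\in{\cal C}.\qquad(*)$$ Let $V'$ be the $k$-module of all natural transformations $PG\to T$, and $V'_5$ the $k$-module of all $(A,A\#C^*)$-bimodule maps $\psi:C\otimes A\to{\rm Hom}(C,A)$. Consider also the following $k$-modules of $k$-linear maps (all conditions for all $a\in A$, $c,d\in C$). * $V_1$: morphisms of Doi-Hopf modules $\nu:C\otimes C\otimes A\to C\otimes A$ with $\nu(c\otimes d\otimes ba)=b\,\nu(c\otimes d\otimes a)$ for $b\in A$ and $\nu(c\otimes d\otimes1)=\sum d_{(2)}\cdot x_{<-1>}\otimes x_{<0>}$ where $x=(\varepsilon\otimes I_A)\nu(c\otimes d_{(1)}\otimes1)$; normalized if $\sum\nu(c_{(1)}\otimes c_{(2)}\otimes a)=c\otimes a$. * $V_2$: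 maps $\lambda:C\otimes C\to C\otimes A$ with $\sum d_{(2)}\cdot x_{<-1>}\otimes x_{<0>}=\lambda(c\otimes d)$ where $x=(\varepsilon\otimes I_A)\lambda(c\otimes d_{(1)})$, $\sum a_{<0>}\lambda(c\cdot a_{<-2>}\otimes d\cdot a_{<-1>})=\lambda(c\otimes d)a$ and $\sum c_{(1)}\otimes\lambda(c_{(2)}\otimes d)=\rho_{C\otimes A}(\lambda(c\otimes d))$; normalized if $\sum\lambda(c_{(1)}\otimes c_{(2)})=c\otimes1$. * $V_3$: maps $\theta:C\otimes C\to A$ with $\theta(c\otimes d)a=\sum a_{<0>}\theta(c\cdot a_{<-2>}\otimes d\cdot a_{<-1>})$ and $\sum c_{(1)}\otimes\theta(c_{(2)}\otimes d)=\sum d_{(2)}\cdot\theta(c\otimes d_{(1)})_{<-1>}\otimes\theta(c\otimes d_{(1)})_{<0>}$; normalized if $\sum\theta(c_{(1)}\otimes c_{(2)})=\varepsilon(c)1$. * $V_4$: maps $\gamma:C\to{\rm Hom}(C,A)$ with $\sum a_{<0>}\cdot\gamma(c\cdot a_{<-1>})=\gamma(c)\cdot a$ and $\sum c_{(1)}\otimes\gamma(c_{(2)})(d)=\sum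 d_{(2)}\cdot\gamma(c)(d_{(1)})_{<-1>}\otimes\gamma(c)(d_{(1)})_{<0>}$; normalized if $\sum\gamma(c_{(1)})(c_{(2)})=\varepsilon(c)1$. * $V_5$: $A$-bimodule maps $\psi:C\otimes A\to{\rm Hom}(C,A)$ such that $c\mapsto\psi(c\otimes1)$ satisfies the second condition of $V_4$; normalized if $\sum\psi(c_{(1)}\otimes1)(c_{(2)})=\varepsilon(c)1$. Then there is an isomorphism of $k$-modules $V'\cong V'_5$ under which $\phi$ and $\psi$ correspond if and only if $\phi_N(c\otimes n)=n\otimes\psi(c\otimes1)$ for all $N\in{\cal M}_A$, $c\in C$, $n\in N$; equivalently, $\psi$ is $\phi_A:C\otimes A\to A\otimes_A\#(C,A)\cong\#(C,A)$. If $C$ is projective as a $k$-module, then for each $i=1,\dots,5$ there is an isomorphism of $k$-modules $V'\cong V_i$ under which the $\phi$ that satisfy $(*)$ correspond to the normalized elements of $V_i$; consequently, for each $i$, $F$ is separable relative to $({\cal M}_{A\#C^*},P,T,\chi)$ if and only if there is a normalized element in $V_i$. -/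

import Mathlib

open TensorProduct MulOpposite CategoryTheory
open scoped ModuleCat.Algebra

universe u₁ u₂ u

set_option linter.unusedSectionVars false

noncomputable section

namespace DoiHopf

/-! ### Relative separability -/

/-- For an adjunction `F ⊣ G` between `𝒞` and `𝒟` with unit `ρ`, functors `P : 𝒞 ⥤ ℬ` and
`T : 𝒟 ⥤ ℬ` and `χ : T F ⟶ P`, the condition `χ ∘ φF ∘ Pρ = 1_P` on `φ : P G ⟶ T`. -/
def IsRelativeSplitting {𝒞 𝒟 ℬ : Type*} [Category* 𝒞] [Category* 𝒟] [Category* ℬ]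
    {F : 𝒞 ⥤ 𝒟} {G : 𝒟 ⥤ 𝒞} (adj : F ⊣ G) (P : 𝒞 ⥤ ℬ) (T : 𝒟 ⥤ ℬ) (χ : F ⋙ T ⟶ P)
    (φ : G ⋙ P ⟶ T) : Prop :=
  ∀ M : 𝒞, P.map (adj.unit.app M) ≫ φ.app (F.obj M) ≫ χ.app M = 𝟙 (P.obj M)

/-- `F` is separable relative to `(ℬ, P, T, χ)`. -/
def IsSeparableRelative {𝒞 𝒟 ℬ : Type*} [Category* 𝒞] [Category* 𝒟] [Category* ℬ]
    {F : 𝒞 ⥤ 𝒟} {G : 𝒟 ⥤ 𝒞} (adj : F ⊣ G) (P : 𝒞 ⥤ ℬ) (T : 𝒟 ⥤ ℬ) (χ : F ⋙ T ⟶ P) : Prop :=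
  ∃ φ : G ⋙ P ⟶ T, IsRelativeSplitting adj P T χ φ

/-! ### Right modules, left coactions, Doi-Hopf data -/

/-- The right action of a `k`-algebra `R` on a right `R`-module `M` (a module over `Rᵐᵒᵖ`), as a
`k`-linear map: `rightAct k R M r m = m · r`. -/
def rightAct (k R M : Type*) [CommRing k] [Ring R] [Algebra k R] [AddCommGroup M] [Module k M]
    [Module Rᵐᵒᵖ M] [IsScalarTower k Rᵐᵒᵖ M] : R →ₗ[k] M →ₗ[k] M :=
  (Algebra.lsmul k k M).toLinearMap ∘ₗ (opLinearEquiv k : R ≃ₗ[k] Rᵐᵒᵖ).toLinearMap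

@[simp]
theorem rightAct_apply (k R M : Type*) [CommRing k] [Ring R] [Algebra k R] [AddCommGroup M]
    [Module k M] [Module Rᵐᵒᵖ M] [IsScalarTower k Rᵐᵒᵖ M] (r : R) (m : M) :
    rightAct k R M r m = op r • m := rfl

/-- For `t = ∑ r ⊗ s` in `R ⊗ S`, the endomorphism `m ⊗ n ↦ ∑ m · r ⊗ n · s` of `M ⊗ N`. -/
def diagAct (k R S M N : Type*) [CommRing k] [Ring R] [Algebra k R] [Ring S] [Algebra k S]
    [AddCommGroup M] [Module k M] [Module Rᵐᵒᵖ M] [IsScalarTower k Rᵐᵒᵖ M]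
    [AddCommGroup N] [Module k N] [Module Sᵐᵒᵖ N] [IsScalarTower k Sᵐᵒᵖ N] :
    R ⊗[k] S →ₗ[k] M ⊗[k] N →ₗ[k] M ⊗[k] N :=
  homTensorHomMap (.id k) M N M N ∘ₗ TensorProduct.map (rightAct k R M) (rightAct k S N)

@[simp]
theorem diagAct_tmul (k R S M N : Type*) [CommRing k] [Ring R] [Algebra k R] [Ring S] [Algebra k S]
    [AddCommGroup M] [Module k M] [Module Rᵐᵒᵖ M] [IsScalarTower k Rᵐᵒᵖ M]
    [AddCommGroup N] [Module k N] [Module Sᵐᵒᵖ N] [IsScalarTower k Sᵐᵒᵖ N]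
    (r : R) (s : S) (m : M) (n : N) :
    diagAct k R S M N (r ⊗ₜ s) (m ⊗ₜ n) = (op r • m) ⊗ₜ (op s • n) := rfl

/-- A `k`-linear map `ρ : M → C ⊗ M` that makes `M` a left comodule over the coalgebra `C`. -/
structure IsLeftCoaction (k C M : Type*) [CommRing k] [AddCommGroup C] [Module k C] [Coalgebra k C]
    [AddCommGroup M] [Module k M] (ρ : M →ₗ[k] C ⊗[k] M) : Prop where
  coassoc : ∀ m, TensorProduct.assoc k C C M ((Coalgebra.comul (R := k) (A := C)).rTensor M (ρ m)) =
    ρ.lTensor C (ρ m)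
  counit : ∀ m, TensorProduct.lid k M ((Coalgebra.counit (R := k) (A := C)).rTensor M (ρ m)) = m

/-- A Doi-Hopf datum `(H, A, C)` over `k`: a bialgebra `H`, a left `H`-comodule algebra `A` and a
right `H`-module coalgebra `C` that is flat over `k`. -/
structure DoiHopfDatum (k : Type u₁) (H : Type u₂) (A C : Type u) [CommRing k] [Ring H]
    [Bialgebra k H] [Ring A] [Algebra k A] [AddCommGroup C] [Module k C] [Coalgebra k C]
    [Module Hᵐᵒᵖ C] [IsScalarTower k Hᵐᵒᵖ C] where
  /-- the coaction `ρ_A(a) = ∑ a₍₋₁₎ ⊗ a₍₀₎`, an algebra map -/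
  coactA : A →ₐ[k] H ⊗[k] A
  isLeftCoaction_coactA : IsLeftCoaction k H A coactA.toLinearMap
  /-- `Δ(c · h) = ∑ c₍₁₎ · h₍₁₎ ⊗ c₍₂₎ · h₍₂₎` -/
  comul_smul : ∀ (c : C) (h : H), Coalgebra.comul (R := k) (op h • c) =
    diagAct k H H C C (Coalgebra.comul (R := k) h) (Coalgebra.comul (R := k) c)
  /-- `ε(c · h) = ε(c) ε(h)` -/
  counit_smul : ∀ (c : C) (h : H), Coalgebra.counit (R := k) (op h • c) =
    Coalgebra.counit (R := k) c * Coalgebra.counit (R := k) h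
  flat : Module.Flat k C

section Aux

variable {k R S M N : Type*} [CommRing k] [Ring R] [Algebra k R] [Ring S] [Algebra k S]
    [AddCommGroup M] [Module k M] [Module Rᵐᵒᵖ M] [IsScalarTower k Rᵐᵒᵖ M]
    [AddCommGroup N] [Module k N] [Module Sᵐᵒᵖ N] [IsScalarTower k Sᵐᵒᵖ N]

theorem diagAct_one : diagAct k R S M N 1 = LinearMap.id := by
  ext m n
  simp [Algebra.TensorProduct.one_def]

theorem diagAct_mul (s t : R ⊗[k] S) (x : M ⊗[k] N) :
    diagAct k R S M N (s * t) x = diagAct k R S M N t (diagAct k R S M N s x) := by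
  induction x with
  | zero => simp
  | add x y hx hy => simp only [map_add, hx, hy]
  | tmul m n =>
    induction s with
    | zero => simp
    | add s s' hs hs' => simp only [add_mul, map_add, LinearMap.add_apply, hs, hs']
    | tmul r a =>
      induction t with
      | zero => simp
      | add s s' hs hs' => simp only [mul_add, map_add, LinearMap.add_apply, hs, hs']
      | tmul r' a' => simp [mul_smul]

end Aux

variable {k : Type u₁} {H : Type u₂} {A C : Type u} [CommRing k] [Ring H] [Bialgebra k H] [Ring A]
  [Algebra k A] [AddCommGroup C] [Module k C] [Coalgebra k C] [Module Hᵐᵒᵖ C]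
  [IsScalarTower k Hᵐᵒᵖ C]

namespace DoiHopfDatum

section Unbundled

variable (D : DoiHopfDatum k H A C)
variable (M : Type*) [AddCommGroup M] [Module k M] [Module Aᵐᵒᵖ M] [IsScalarTower k Aᵐᵒᵖ M]

/-- The right action of `A` on `C ⊗ M`: `(c ⊗ m) · a = ∑ c · a₍₋₁₎ ⊗ m a₍₀₎`. -/
def act : A →ₗ[k] C ⊗[k] M →ₗ[k] C ⊗[k] M := diagAct k H A C M ∘ₗ D.coactA.toLinearMap

theorem act_apply (a : A) : D.act M a = diagAct k H A C M (D.coactA a) := rfl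

theorem act_one : D.act M 1 = LinearMap.id := by rw [act_apply, map_one, diagAct_one]

theorem act_mul (a b : A) (x : C ⊗[k] M) : D.act M (a * b) x = D.act M b (D.act M a x) := by
  simp only [act_apply, map_mul, diagAct_mul]

/-- The compatibility relation `ρ(m a) = ∑ m₍₋₁₎ · a₍₋₁₎ ⊗ m₍₀₎ a₍₀₎` together with the axioms of a
left `C`-comodule. -/
structure IsDoiHopfCoaction {M : Type*} [AddCommGroup M] [Module k M] [Module Aᵐᵒᵖ M]
    [IsScalarTower k Aᵐᵒᵖ M] (ρ : M →ₗ[k] C ⊗[k] M) : Prop where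
  isLeftCoaction : IsLeftCoaction k C M ρ
  compat : ∀ (m : M) (a : A), ρ (op a • m) = D.act M a (ρ m)

/-- The `k`-module `C ⊗ M` underlying the Doi-Hopf module `G(M)`. -/
def Ind (_ : DoiHopfDatum k H A C) (M : Type*) [AddCommGroup M] [Module k M] : Type _ := C ⊗[k] M

instance : AddCommGroup (D.Ind M) := inferInstanceAs (AddCommGroup (C ⊗[k] M))
instance : Module k (D.Ind M) := inferInstanceAs (Module k (C ⊗[k] M))

/-- The right `A`-module structure of `G(M) = C ⊗ M`. -/
instance : Module Aᵐᵒᵖ (D.Ind M) where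
  smul a x := D.act M (unop a) x
  one_smul x := LinearMap.congr_fun (D.act_one M) x
  mul_smul a b x := D.act_mul M (unop b) (unop a) x
  smul_zero a := map_zero (D.act M (unop a))
  smul_add a := map_add (D.act M (unop a))
  add_smul a b x := LinearMap.congr_fun (map_add (D.act M) (unop a) (unop b)) x
  zero_smul x := LinearMap.congr_fun (map_zero (D.act M)) x

instance : IsScalarTower k Aᵐᵒᵖ (D.Ind M) where
  smul_assoc r a x := LinearMap.congr_fun (map_smul (D.act M) r (unop a)) x

variable {M}

/-- The element `c ⊗ m` of `G(M)`. -/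
def tmul (c : C) (m : M) : D.Ind M := c ⊗ₜ[k] m

theorem op_smul_ind (a : A) (x : D.Ind M) : op a • x = D.act M a x := rfl

variable (M)

/-- The coaction `c ⊗ m ↦ ∑ c₍₁₎ ⊗ c₍₂₎ ⊗ m` of `G(M) = C ⊗ M`. -/
def indCoact : D.Ind M →ₗ[k] C ⊗[k] D.Ind M :=
  ((TensorProduct.assoc k C C M).toLinearMap ∘ₗ (Coalgebra.comul (R := k) (A := C)).rTensor M :
    C ⊗[k] M →ₗ[k] C ⊗[k] (C ⊗[k] M))

/-- The map `c ⊗ m ↦ ε(c) m` from `G(M)` to `M`. -/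
def indCounit : D.Ind M →ₗ[k] M :=
  ((TensorProduct.lid k M).toLinearMap ∘ₗ (Coalgebra.counit (R := k) (A := C)).rTensor M :
    C ⊗[k] M →ₗ[k] M)

theorem comul_diagAct (D : DoiHopfDatum k H A C) (t : H ⊗[k] A) (x : C ⊗[k] M) :
    TensorProduct.assoc k C C M ((Coalgebra.comul (R := k) (A := C)).rTensor M
      (diagAct k H A C M t x)) =
      homTensorHomMap (.id k) C (C ⊗[k] M) C (C ⊗[k] M)
        (TensorProduct.map (rightAct k H C) (diagAct k H A C M)
        (TensorProduct.assoc k H H A ((Coalgebra.comul (R := k) (A := H)).rTensor A t)))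
        (TensorProduct.assoc k C C M ((Coalgebra.comul (R := k) (A := C)).rTensor M x)) := by
  induction x with
  | zero => simp
  | add x y hx hy => simp only [map_add, hx, hy]
  | tmul c m =>
    induction t with
    | zero => simp
    | add s s' hs hs' => simp only [map_add, LinearMap.add_apply, hs, hs']
    | tmul h a =>
      simp only [diagAct_tmul, LinearMap.rTensor_tmul, D.comul_smul]
      generalize Coalgebra.comul (R := k) h = u
      generalize Coalgebra.comul (R := k) c = v
      induction u with
      | zero => simp
      | add s s' hs hs' => simp only [map_add, LinearMap.add_apply, add_tmul, hs, hs']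
      | tmul h h' =>
        induction v with
        | zero => simp
        | add s s' hs hs' => simp only [map_add, add_tmul, hs, hs']
        | tmul c c' => rfl

theorem isLeftCoaction_ind : IsLeftCoaction k C (C ⊗[k] M)
    ((TensorProduct.assoc k C C M).toLinearMap ∘ₗ
      (Coalgebra.comul (R := k) (A := C)).rTensor M) where
  coassoc := fun x => by
    induction x using TensorProduct.induction_on with
    | zero => simp
    | add x y hx hy => simp only [map_add, hx, hy]
    | tmul c m =>
      have h := congrArg (fun z => (TensorProduct.assoc k C C M).toLinearMap.lTensor C
        (TensorProduct.assoc k C (C ⊗[k] C) M (z ⊗ₜ[k] m)))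
        (Coalgebra.coassoc_apply (R := k) c)
      simp only [LinearMap.comp_apply, LinearMap.rTensor_tmul]
      generalize Coalgebra.comul (R := k) c = v at h
      refine Eq.trans ?_ (h.trans ?_)
      · clear h
        induction v with
        | zero => simp
        | add s s' hs hs' => simp only [map_add, add_tmul, hs, hs']
        | tmul c c' =>
          simp only [LinearMap.rTensor_tmul, LinearEquiv.coe_coe, TensorProduct.assoc_tmul]
          generalize Coalgebra.comul (R := k) c = v
          induction v with
          | zero => simp
          | add s s' hs hs' => simp only [map_add, add_tmul, hs, hs']
          | tmul c c' => rfl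
      · clear h
        induction v with
        | zero => simp
        | add s s' hs hs' => simp only [map_add, add_tmul, hs, hs']
        | tmul c c' => rfl
  counit := fun x => by
    induction x using TensorProduct.induction_on with
    | zero => simp
    | add x y hx hy => simp only [map_add, hx, hy]
    | tmul c m =>
      have h := congrArg (fun z => (TensorProduct.lid k C z) ⊗ₜ[k] m)
        (Coalgebra.rTensor_counit_comul (R := k) c)
      simp only [TensorProduct.lid_tmul, one_smul] at h
      simp only [LinearMap.comp_apply, LinearMap.rTensor_tmul]
      generalize Coalgebra.comul (R := k) c = v at h
      refine Eq.trans ?_ h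
      clear h
      induction v with
      | zero => simp
      | add s s' hs hs' => simp only [map_add, add_tmul, hs, hs']
      | tmul c c' => rfl

theorem isDoiHopfCoaction_indCoact : D.IsDoiHopfCoaction (D.indCoact M) where
  isLeftCoaction :=
    { coassoc := (isLeftCoaction_ind (C := C) M).coassoc
      counit := (isLeftCoaction_ind (C := C) M).counit }
  compat x a := by
    refine (D.comul_diagAct M (D.coactA a) x).trans ?_
    have h := D.isLeftCoaction_coactA.coassoc a
    simp only [AlgHom.toLinearMap_apply] at h
    rw [h]
    change _ = diagAct k H A C (D.Ind M) (D.coactA a) (TensorProduct.assoc k C C M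
      ((Coalgebra.comul (R := k) (A := C)).rTensor M x))
    generalize D.coactA a = t
    generalize TensorProduct.assoc k C C M
      ((Coalgebra.comul (R := k) (A := C)).rTensor M x) = y
    induction t with
    | zero => simp; rfl
    | add s s' hs hs' =>
      simp only [map_add, LinearMap.add_apply, hs, hs']
      rfl
    | tmul h b =>
      induction y using TensorProduct.induction_on with
      | zero => simp only [map_zero]; rfl
      | add s s' hs hs' =>
        refine (map_add _ s s').trans (Eq.trans ?_ (map_add (diagAct k H A C (D.Ind M)
          (h ⊗ₜ[k] b)) s s').symm)
        exact congrArg₂ (· + ·) hs hs'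
      | tmul c z => rfl

theorem counit_diagAct (D : DoiHopfDatum k H A C) (t : H ⊗[k] A) (x : C ⊗[k] M) :
    TensorProduct.lid k M ((Coalgebra.counit (R := k) (A := C)).rTensor M
      (diagAct k H A C M t x)) =
    rightAct k A M (TensorProduct.lid k A ((Coalgebra.counit (R := k) (A := H)).rTensor A t))
      (TensorProduct.lid k M ((Coalgebra.counit (R := k) (A := C)).rTensor M x)) := by
  induction t with
  | zero => simp
  | add s s' hs hs' => simp only [map_add, LinearMap.add_apply, hs, hs']
  | tmul h b =>
    induction x with
    | zero => simp
    | add s s' hs hs' => simp only [map_add, hs, hs']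
    | tmul c z =>
      simp only [diagAct_tmul, LinearMap.rTensor_tmul, TensorProduct.lid_tmul, D.counit_smul,
        map_smul, LinearMap.smul_apply, rightAct_apply]
      rw [smul_smul, mul_comm]

variable {M} in
theorem indCounit_smul (a : A) (x : D.Ind M) :
    D.indCounit M (op a • x) = op a • D.indCounit M x := by
  refine (D.counit_diagAct M (D.coactA a) x).trans ?_
  have h := D.isLeftCoaction_coactA.counit a
  simp only [AlgHom.toLinearMap_apply] at h
  rw [h]
  rfl

/-! ### Koppinen's smash product `#(C, A)` -/

variable {M} in
/-- `m ◁ f = ∑ m₍₀₎ f(m₍₋₁₎)` for a map `ρ(m) = ∑ m₍₋₁₎ ⊗ m₍₀₎` and `f : C → A`. -/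
def tri (_ : DoiHopfDatum k H A C) (ρ : M →ₗ[k] C ⊗[k] M) (f : C →ₗ[k] A) : M →ₗ[k] M :=
  TensorProduct.lift (rightAct k A M ∘ₗ f) ∘ₗ ρ

/-- For `a` in `A` and `c` in `C`, the element `∑ c · a₍₋₁₎ ⊗ a₍₀₎` of `C ⊗ A`. -/
def twist : A →ₗ[k] C →ₗ[k] C ⊗[k] A :=
  LinearMap.mk₂ k
    (fun a c => TensorProduct.map ((rightAct k H C).flip c) LinearMap.id (D.coactA a))
    (fun a b c => by simp) (fun r a c => by simp)
    (fun a c d => by rw [map_add, TensorProduct.map_add_left, LinearMap.add_apply])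
    (fun r a c => by rw [map_smul, TensorProduct.map_smul_left, LinearMap.smul_apply])

/-- For `f : C → A`, the map `c ↦ ∑ c₍₂₎ · f(c₍₁₎)₍₋₁₎ ⊗ f(c₍₁₎)₍₀₎` from `C` to `C ⊗ A`. -/
def spread (f : C →ₗ[k] A) : C →ₗ[k] C ⊗[k] A :=
  TensorProduct.lift (D.twist ∘ₗ f) ∘ₗ Coalgebra.comul

/-- For `g : C → A`, the map `c ⊗ a ↦ a g(c)` from `C ⊗ A` to `A`. -/
def contract (_ : DoiHopfDatum k H A C) (g : C →ₗ[k] A) : C ⊗[k] A →ₗ[k] A :=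
  TensorProduct.lift ((LinearMap.mul k A).flip ∘ₗ g)

/-- The product `(f • g)(c) = ∑ f(c₍₁₎)₍₀₎ g(c₍₂₎ · f(c₍₁₎)₍₋₁₎)` on `Hom(C, A)`. -/
def kmul (f g : C →ₗ[k] A) : C →ₗ[k] A := D.contract g ∘ₗ D.spread f

theorem act_tmul_one (a : A) (c : C) : D.act A a (c ⊗ₜ[k] 1) = D.twist a c := by
  simp only [act_apply, twist, LinearMap.mk₂_apply]
  generalize D.coactA a = t
  induction t with
  | zero => simp
  | add s s' hs hs' => simp only [map_add, LinearMap.add_apply, hs, hs']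
  | tmul h b => simp

variable {D M} in
theorem tri_kmul {ρ : M →ₗ[k] C ⊗[k] M} (hρ : D.IsDoiHopfCoaction ρ) (f g : C →ₗ[k] A) (m : M) :
    D.tri ρ (D.kmul f g) m = D.tri ρ g (D.tri ρ f m) := by
  have h1 : ∀ t : C ⊗[k] M, ρ (TensorProduct.lift (rightAct k A M ∘ₗ f) t) =
      TensorProduct.lift (D.act M ∘ₗ f) (ρ.lTensor C t) := by
    intro t
    induction t with
    | zero => simp
    | add s s' hs hs' => simp only [map_add, hs, hs']
    | tmul c z => simp [hρ.compat]
  simp only [tri, LinearMap.comp_apply]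
  rw [h1, ← hρ.isLeftCoaction.coassoc]
  generalize ρ m = t
  induction t with
  | zero => simp
  | add s s' hs hs' => simp only [map_add, hs, hs']
  | tmul c z =>
    simp only [TensorProduct.lift.tmul, LinearMap.rTensor_tmul, LinearMap.comp_apply,
      kmul, spread]
    generalize Coalgebra.comul (R := k) c = v
    induction v with
    | zero => simp
    | add s s' hs hs' => simp only [map_add, add_tmul, LinearMap.add_apply, hs, hs']
    | tmul x y =>
      simp only [TensorProduct.assoc_tmul, TensorProduct.lift.tmul, LinearMap.comp_apply,
        ← act_tmul_one, act_apply]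
      generalize D.coactA (f x) = t
      induction t with
      | zero => simp
      | add s s' hs hs' => simp only [map_add, LinearMap.add_apply, hs, hs']
      | tmul h b => simp [contract, mul_smul]

theorem contract_eq (g : C →ₗ[k] A) (x : D.Ind A) :
    D.contract g x = D.indCounit A (D.tri (D.indCoact A) g x) := by
  have key : ∀ (c : C) (a : A), D.contract g (c ⊗ₜ a) =
      D.indCounit A (D.tri (D.indCoact A) g (D.tmul c a)) := by
    intro c a
    have h2 := congrArg (fun z => a * g (TensorProduct.rid k C z))
      (Coalgebra.lTensor_counit_comul (R := k) c)
    simp only [TensorProduct.rid_tmul, one_smul] at h2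
    change _ = D.indCounit A (TensorProduct.lift (rightAct k A (D.Ind A) ∘ₗ g)
      (TensorProduct.assoc k C C A (Coalgebra.comul (R := k) c ⊗ₜ[k] a)))
    refine Eq.trans h2.symm ?_
    generalize Coalgebra.comul (R := k) c = v
    induction v with
    | zero =>
      simp only [map_zero, zero_tmul, mul_zero]
      exact (((D.indCounit A) ∘ₗ
        (TensorProduct.lift (rightAct k A (D.Ind A) ∘ₗ g))).map_zero).symm
    | add s s' hs hs' =>
      simp only [map_add, add_tmul, mul_add]
      exact (congrArg₂ (· + ·) hs hs').trans (((D.indCounit A) ∘ₗ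
        (TensorProduct.lift (rightAct k A (D.Ind A) ∘ₗ g))).map_add _ _).symm
    | tmul x y =>
      refine Eq.trans ?_ (D.indCounit_smul (g x) (D.tmul y a)).symm
      change _ = TensorProduct.lid k A ((Coalgebra.counit (R := k) (A := C)).rTensor A
        (y ⊗ₜ[k] a)) * g x
      simp
  let T : D.Ind A →ₗ[k] A := D.indCounit A ∘ₗ D.tri (D.indCoact A) g
  exact LinearMap.congr_fun (TensorProduct.ext' (h := (T : C ⊗[k] A →ₗ[k] A)) key) x

theorem spread_eq (f : C →ₗ[k] A) (c : C) :
    D.spread f c = D.tri (D.indCoact A) f (D.tmul c 1) := by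
  change _ = TensorProduct.lift (rightAct k A (D.Ind A) ∘ₗ f)
      (TensorProduct.assoc k C C A (Coalgebra.comul (R := k) c ⊗ₜ[k] 1))
  simp only [spread, LinearMap.comp_apply]
  generalize Coalgebra.comul (R := k) c = v
  induction v with
  | zero =>
    simp only [map_zero, zero_tmul]
    exact ((TensorProduct.lift (rightAct k A (D.Ind A) ∘ₗ f)).map_zero).symm
  | add s s' hs hs' =>
    simp only [map_add, add_tmul]
    exact (congrArg₂ (· + ·) hs hs').trans
      ((TensorProduct.lift (rightAct k A (D.Ind A) ∘ₗ f)).map_add _ _).symm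
  | tmul x y => exact (D.act_tmul_one (f x) y).symm

theorem kmul_apply (f g : C →ₗ[k] A) (c : C) : D.kmul f g c =
    D.indCounit A (D.tri (D.indCoact A) g (D.tri (D.indCoact A) f (D.tmul c 1))) :=
  by
  rw [← contract_eq, ← spread_eq]; rfl

theorem kmul_assoc (f g h : C →ₗ[k] A) : D.kmul (D.kmul f g) h = D.kmul f (D.kmul g h) := by
  ext c
  simp only [kmul_apply, tri_kmul (D.isDoiHopfCoaction_indCoact A)]

/-- The unit `c ↦ ε(c) 1` of `#(C, A)`. -/
def kone (_ : DoiHopfDatum k H A C) : C →ₗ[k] A := Algebra.linearMap k A ∘ₗ Coalgebra.counit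

variable {D M} in
theorem tri_kone {ρ : M →ₗ[k] C ⊗[k] M} (hρ : D.IsDoiHopfCoaction ρ) (m : M) :
    D.tri ρ D.kone m = m := by
  conv_rhs => rw [← hρ.isLeftCoaction.counit m]
  simp only [tri, LinearMap.comp_apply]
  generalize ρ m = t
  induction t with
  | zero => simp
  | add s s' hs hs' => simp only [map_add, hs, hs']
  | tmul c z => simp [kone, Algebra.algebraMap_eq_smul_one]

theorem kone_kmul (f : C →ₗ[k] A) : D.kmul D.kone f = f := by
  ext c
  rw [kmul_apply, tri_kone (D.isDoiHopfCoaction_indCoact A), ← contract_eq]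
  simp [contract, tmul]

theorem kmul_kone (f : C →ₗ[k] A) : D.kmul f D.kone = f := by
  ext c
  rw [kmul_apply, tri_kone (D.isDoiHopfCoaction_indCoact A), ← contract_eq, tmul]
  simp [contract]

end Unbundled

variable (D : DoiHopfDatum k H A C)

/-- Koppinen's smash product `#(C, A)`: the `k`-module `Hom(C, A)` with the product
`(f • g)(c) = ∑ f(c₍₁₎)₍₀₎ g(c₍₂₎ · f(c₍₁₎)₍₋₁₎)`. -/
def Koppinen (_ : DoiHopfDatum k H A C) : Type u := C →ₗ[k] A

instance : AddCommGroup D.Koppinen := inferInstanceAs (AddCommGroup (C →ₗ[k] A))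
instance : Module k D.Koppinen := inferInstanceAs (Module k (C →ₗ[k] A))
instance : FunLike D.Koppinen C A := inferInstanceAs (FunLike (C →ₗ[k] A) C A)

theorem tri_add (M : Type*) [AddCommGroup M] [Module k M] [Module Aᵐᵒᵖ M]
    [IsScalarTower k Aᵐᵒᵖ M] (ρ : M →ₗ[k] C ⊗[k] M) (f g : C →ₗ[k] A) :
    D.tri ρ (f + g) = D.tri ρ f + D.tri ρ g := by
  ext m
  simp only [tri, LinearMap.comp_apply, LinearMap.add_apply]
  generalize ρ m = t
  induction t with
  | zero => simp
  | add s s' hs hs' => simp only [map_add, hs, hs']; abel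
  | tmul c z => simp

theorem tri_smul (M : Type*) [AddCommGroup M] [Module k M] [Module Aᵐᵒᵖ M]
    [IsScalarTower k Aᵐᵒᵖ M] (ρ : M →ₗ[k] C ⊗[k] M) (r : k) (f : C →ₗ[k] A) :
    D.tri ρ (r • f) = r • D.tri ρ f := by
  ext m
  simp only [tri, LinearMap.comp_apply, LinearMap.smul_apply]
  generalize ρ m = t
  induction t with
  | zero => simp
  | add s s' hs hs' => simp only [map_add, hs, hs', smul_add]
  | tmul c z => simp

theorem kmul_add (f g h : C →ₗ[k] A) : D.kmul f (g + h) = D.kmul f g + D.kmul f h := by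
  ext c; simp only [kmul_apply, tri_add, LinearMap.add_apply, map_add]

theorem add_kmul (f g h : C →ₗ[k] A) : D.kmul (f + g) h = D.kmul f h + D.kmul g h := by
  ext c; simp only [kmul_apply, tri_add, LinearMap.add_apply, map_add]

theorem kmul_smul (r : k) (f g : C →ₗ[k] A) : D.kmul f (r • g) = r • D.kmul f g := by
  ext c; simp only [kmul_apply, tri_smul, LinearMap.smul_apply, map_smul]

theorem smul_kmul (r : k) (f g : C →ₗ[k] A) : D.kmul (r • f) g = r • D.kmul f g := by
  ext c; simp only [kmul_apply, tri_smul, LinearMap.smul_apply, map_smul]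

theorem kmul_zero (f : C →ₗ[k] A) : D.kmul f 0 = 0 := by
  simpa using D.kmul_smul 0 f 0

theorem zero_kmul (f : C →ₗ[k] A) : D.kmul 0 f = 0 := by
  simpa using D.smul_kmul 0 0 f

instance : Ring D.Koppinen :=
  { (inferInstance : AddCommGroup D.Koppinen) with
  mul f g := D.kmul f g
  one := D.kone
  mul_assoc := D.kmul_assoc
  one_mul := D.kone_kmul
  mul_one := D.kmul_kone
  left_distrib := D.kmul_add
  right_distrib := D.add_kmul
  zero_mul := D.zero_kmul
  mul_zero := D.kmul_zero }

instance : Algebra k D.Koppinen := Algebra.ofModule D.smul_kmul D.kmul_smul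

/-! ### The smash product `A # C*` -/

variable (k C) in
/-- The dual `C* = Hom(C, k)` with the convolution product. -/
abbrev ConvDual : Type _ := WithConv (C →ₗ[k] k)

variable (k H C) in
/-- The left action of `H` on `C*`: `⟨h · c*, c⟩ = ⟨c*, c · h⟩`. -/
def dualAct : H →ₗ[k] ConvDual k C →ₗ[k] ConvDual k C :=
  LinearMap.mk₂ k (fun h f => WithConv.toConv (f.ofConv ∘ₗ rightAct k H C h))
    (fun h h' f => by ext c; simp) (fun r h f => by ext c; simp)
    (fun h f f' => by ext c; simp) (fun r h f => by ext c; simp)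

theorem dualAct_apply (h : H) (f : ConvDual k C) (c : C) :
    dualAct k H C h f c = f (op h • c) := rfl

theorem dualAct_one (f : ConvDual k C) : dualAct k H C 1 f = f := by
  ext c; simp [dualAct_apply]

theorem dualAct_mul_left (h h' : H) (f : ConvDual k C) :
    dualAct k H C (h * h') f = dualAct k H C h (dualAct k H C h' f) := by
  ext c; simp [dualAct_apply, mul_smul]

theorem dualAct_conv_one (D : DoiHopfDatum k H A C) (h : H) :
    dualAct k H C h 1 = Coalgebra.counit (R := k) h • 1 := by
  ext c; simp [dualAct_apply, D.counit_smul, mul_comm]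

theorem dualAct_conv_mul (D : DoiHopfDatum k H A C) (h : H) (f g : ConvDual k C) :
    dualAct k H C h (f * g) = LinearMap.mul' k (ConvDual k C)
      (TensorProduct.map ((dualAct k H C).flip f) ((dualAct k H C).flip g)
        (Coalgebra.comul (R := k) h)) := by
  ext c
  rw [dualAct_apply, LinearMap.convMul_apply, D.comul_smul]
  generalize Coalgebra.comul (R := k) h = t
  induction t with
  | zero => simp
  | add s s' hs hs' =>
    simp only [map_add, LinearMap.add_apply, hs, hs', WithConv.ofConv_add]
  | tmul x y =>
    simp only [TensorProduct.map_tmul, LinearMap.mul'_apply, LinearMap.convMul_apply]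
    generalize Coalgebra.comul (R := k) c = v
    induction v with
    | zero => simp
    | add s s' hs hs' => simp only [map_add, hs, hs']
    | tmul x y => simp [dualAct_apply]

/-- For `t = ∑ h ⊗ x` in `H ⊗ A`, the endomorphism `b ⊗ d* ↦ ∑ x b ⊗ h · d*` of `A ⊗ C*`. -/
def smashTwist : H ⊗[k] A →ₗ[k] A ⊗[k] ConvDual k C →ₗ[k] A ⊗[k] ConvDual k C :=
  homTensorHomMap (.id k) A (ConvDual k C) A (ConvDual k C) ∘ₗ
    TensorProduct.map (LinearMap.mul k A) (dualAct k H C) ∘ₗ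
      (TensorProduct.comm k H A).toLinearMap

@[simp]
theorem smashTwist_tmul (h : H) (x b : A) (d : ConvDual k C) :
    smashTwist (h ⊗ₜ[k] x) (b ⊗ₜ[k] d) = (x * b) ⊗ₜ dualAct k H C h d := rfl

theorem smashTwist_one : smashTwist (1 : H ⊗[k] A) = (LinearMap.id : A ⊗[k] ConvDual k C →ₗ[k] _) := by
  ext1
  ext1 b
  ext1 d
  simp [Algebra.TensorProduct.one_def, dualAct_one]

theorem smashTwist_mul (s t : H ⊗[k] A) (x : A ⊗[k] ConvDual k C) :
    smashTwist (s * t) x = smashTwist s (smashTwist t x) := by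
  induction x with
  | zero => simp
  | add x y hx hy => simp only [map_add, hx, hy]
  | tmul m n =>
    induction s with
    | zero => simp
    | add s s' hs hs' => simp only [add_mul, map_add, LinearMap.add_apply, hs, hs']
    | tmul r a =>
      induction t with
      | zero => simp
      | add s s' hs hs' => simp only [mul_add, map_add, LinearMap.add_apply, hs, hs']
      | tmul r' a' => simp [mul_assoc, dualAct_mul_left]

/-- The endomorphism `b ⊗ d* ↦ b ⊗ c* * d*` of `A ⊗ C*`. -/
def convMulLeft : ConvDual k C →ₗ[k] A ⊗[k] ConvDual k C →ₗ[k] A ⊗[k] ConvDual k C :=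
  LinearMap.lTensorHom A ∘ₗ LinearMap.mul k (ConvDual k C)

@[simp]
theorem convMulLeft_tmul (f d : ConvDual k C) (b : A) :
    convMulLeft f (b ⊗ₜ[k] d) = b ⊗ₜ (f * d) := rfl

theorem convMulLeft_mul (f d : ConvDual k C) (x : A ⊗[k] ConvDual k C) :
    convMulLeft (f * d) x = convMulLeft f (convMulLeft d x) := by
  induction x with
  | zero => simp
  | add x y hx hy => simp only [map_add, hx, hy]
  | tmul b e => simp [mul_assoc]

/-- The product `(a # c*) (b # d*) = ∑ a₍₀₎ b # c* * (a₍₋₁₎ · d*)`. -/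
def smashMul : A ⊗[k] ConvDual k C →ₗ[k] A ⊗[k] ConvDual k C →ₗ[k] A ⊗[k] ConvDual k C :=
  TensorProduct.lift (LinearMap.mk₂ k (fun a f => convMulLeft f ∘ₗ smashTwist (D.coactA a))
    (fun a b f => by rw [map_add, map_add, LinearMap.comp_add])
    (fun r a f => by rw [map_smul, map_smul, LinearMap.comp_smul])
    (fun a f g => by rw [map_add, LinearMap.add_comp])
    (fun r a f => by rw [map_smul, LinearMap.smul_comp]))

theorem smashMul_tmul (a : A) (f : ConvDual k C) (z : A ⊗[k] ConvDual k C) :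
    D.smashMul (a ⊗ₜ f) z = convMulLeft f (smashTwist (D.coactA a) z) := rfl

/-- An auxiliary map for the associativity of the smash product. -/
def smashAux (d : ConvDual k C) (w : A ⊗[k] ConvDual k C) :
    H ⊗[k] (H ⊗[k] A) →ₗ[k] A ⊗[k] ConvDual k C :=
  TensorProduct.lift (LinearMap.mk₂ k
    (fun h u => convMulLeft (dualAct k H C h d) (smashTwist u w))
    (fun h h' u => by rw [map_add, LinearMap.add_apply, map_add, LinearMap.add_apply])
    (fun r h u => by rw [map_smul, LinearMap.smul_apply, map_smul, LinearMap.smul_apply])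
    (fun h u u' => by rw [map_add, LinearMap.add_apply, map_add])
    (fun r h u => by rw [map_smul, LinearMap.smul_apply, map_smul]))

theorem smashAux_tmul (d : ConvDual k C) (w : A ⊗[k] ConvDual k C) (h : H) (u : H ⊗[k] A) :
    smashAux d w (h ⊗ₜ u) = convMulLeft (dualAct k H C h d) (smashTwist u w) := rfl

theorem smashAux_zero (d : ConvDual k C) (q : H ⊗[k] (H ⊗[k] A)) : smashAux d 0 q = 0 := by
  induction q with
  | zero => simp
  | add s s' hs hs' => rw [map_add, hs, hs', add_zero]
  | tmul x y => simp [smashAux_tmul]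

theorem smashAux_add (d : ConvDual k C) (w w' : A ⊗[k] ConvDual k C) (q : H ⊗[k] (H ⊗[k] A)) :
    smashAux d (w + w') q = smashAux d w q + smashAux d w' q := by
  induction q with
  | zero => simp
  | add s s' hs hs' => rw [map_add, map_add, map_add, hs, hs']; abel
  | tmul x y => simp [smashAux_tmul]

theorem smashTwist_convMulLeft (D : DoiHopfDatum k H A C) (d : ConvDual k C)
    (w : A ⊗[k] ConvDual k C) (t : H ⊗[k] A) : smashTwist t (convMulLeft d w) =
      smashAux d w
        (TensorProduct.assoc k H H A ((Coalgebra.comul (R := k) (A := H)).rTensor A t)) := by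
  induction t with
  | zero => simp
  | add s s' hs hs' => simp only [map_add, LinearMap.add_apply, hs, hs']
  | tmul h x =>
    induction w with
    | zero => rw [map_zero, map_zero, smashAux_zero]
    | add w w' hs hs' => rw [map_add, map_add, hs, hs', smashAux_add]
    | tmul e f =>
      simp only [convMulLeft_tmul, smashTwist_tmul, D.dualAct_conv_mul, LinearMap.rTensor_tmul]
      generalize Coalgebra.comul (R := k) h = v
      induction v with
      | zero => simp
      | add s s' hs hs' => simp only [map_add, add_tmul, tmul_add, hs, hs']
      | tmul x y => simp [smashAux_tmul]

theorem smashMul_smashTwist (a b : A) (d : ConvDual k C) (z : A ⊗[k] ConvDual k C) :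
    D.smashMul (smashTwist (D.coactA a) (b ⊗ₜ d)) z =
      smashTwist (D.coactA a) (D.smashMul (b ⊗ₜ d) z) := by
  have h1 : ∀ t : H ⊗[k] A, D.smashMul (smashTwist t (b ⊗ₜ d)) z =
      smashAux d (smashTwist (D.coactA b) z) (D.coactA.toLinearMap.lTensor H t) := by
    intro t
    induction t with
    | zero => simp
    | add s s' hs hs' => simp only [map_add, LinearMap.add_apply, hs, hs']
    | tmul h x =>
      rw [smashTwist_tmul, smashMul_tmul, map_mul, smashTwist_mul]
      rfl
  rw [h1, smashMul_tmul, D.smashTwist_convMulLeft]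
  congr 1
  exact (D.isLeftCoaction_coactA.coassoc a).symm

theorem smashMul_assoc (x y z : A ⊗[k] ConvDual k C) :
    D.smashMul (D.smashMul x y) z = D.smashMul x (D.smashMul y z) := by
  induction x with
  | zero => simp
  | add s s' hs hs' => simp only [map_add, LinearMap.add_apply, hs, hs']
  | tmul a f =>
    induction y with
    | zero => simp
    | add s s' hs hs' => simp only [map_add, LinearMap.add_apply, hs, hs']
    | tmul b d =>
      rw [smashMul_tmul _ a f, smashMul_tmul _ a f, ← smashMul_smashTwist]
      generalize smashTwist (D.coactA a) (b ⊗ₜ d) = y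
      induction y with
      | zero => simp
      | add s s' hs hs' => simp only [map_add, LinearMap.add_apply, hs, hs']
      | tmul b d =>
        rw [convMulLeft_tmul, smashMul_tmul, smashMul_tmul, convMulLeft_mul]

theorem one_smashMul (x : A ⊗[k] ConvDual k C) : D.smashMul (1 ⊗ₜ 1) x = x := by
  rw [smashMul_tmul, map_one D.coactA, smashTwist_one, LinearMap.id_apply]
  induction x with
  | zero => simp
  | add s s' hs hs' => simp only [map_add, hs, hs']
  | tmul b f => simp

theorem smashMul_one (x : A ⊗[k] ConvDual k C) : D.smashMul x (1 ⊗ₜ 1) = x := by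
  induction x with
  | zero => simp
  | add s s' hs hs' => simp only [map_add, LinearMap.add_apply, hs, hs']
  | tmul a f =>
    rw [smashMul_tmul]
    have h := D.isLeftCoaction_coactA.counit a
    simp only [AlgHom.toLinearMap_apply] at h
    conv_rhs => rw [← h]
    generalize D.coactA a = t
    induction t with
    | zero => simp
    | add s s' hs hs' => simp only [map_add, LinearMap.add_apply, hs, hs', add_tmul]
    | tmul h x => simp [D.dualAct_conv_one, smul_tmul]


/-- The smash product `A # C*`: the `k`-module `A ⊗ C*` with the product
`(a # c*) (b # d*) = ∑ a₍₀₎ b # c* * (a₍₋₁₎ · d*)`. -/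
def Smash (_ : DoiHopfDatum k H A C) : Type (max u u₁) := A ⊗[k] ConvDual k C

instance : AddCommGroup D.Smash := inferInstanceAs (AddCommGroup (A ⊗[k] ConvDual k C))
instance : Module k D.Smash := inferInstanceAs (Module k (A ⊗[k] ConvDual k C))

instance : Ring D.Smash :=
  { (inferInstance : AddCommGroup D.Smash) with
  mul x y := D.smashMul x y
  one := (1 : A) ⊗ₜ[k] (1 : ConvDual k C)
  mul_assoc := D.smashMul_assoc
  one_mul := D.one_smashMul
  mul_one := D.smashMul_one
  left_distrib x y z := map_add (D.smashMul x) y z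
  right_distrib x y z := LinearMap.congr_fun (map_add D.smashMul x y) z
  zero_mul x := LinearMap.congr_fun (map_zero D.smashMul) x
  mul_zero x := map_zero (D.smashMul x) }

instance : Algebra k D.Smash :=
  Algebra.ofModule (fun r x y => LinearMap.congr_fun (map_smul D.smashMul r x) y)
    (fun r x y => map_smul (D.smashMul x) r y)

/-- The element `a # c*` of `A # C*`. -/
def smash (a : A) (f : ConvDual k C) : D.Smash := a ⊗ₜ[k] f

/-- The linear map underlying `i : A # C* → #(C, A)`, `i(a # c*)(c) = ⟨c*, c⟩ a`. -/
def smashToHom (_ : DoiHopfDatum k H A C) : A ⊗[k] ConvDual k C →ₗ[k] C →ₗ[k] A :=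
  TensorProduct.lift (LinearMap.mk₂ k (fun a f => LinearMap.toSpanSingleton k A a ∘ₗ f.ofConv)
    (fun a b f => by ext; simp) (fun r a f => by ext c; exact smul_comm _ _ _)
    (fun a f g => by ext; simp [add_smul]) (fun r a f => by ext; simp [mul_smul]))

theorem smashToHom_tmul (a : A) (f : ConvDual k C) (c : C) :
    D.smashToHom (a ⊗ₜ f) c = f c • a := rfl

theorem smashToHom_convMulLeft (f : ConvDual k C) (z : A ⊗[k] ConvDual k C) (c : C) :
    D.smashToHom (convMulLeft f z) c = TensorProduct.lift
      ((LinearMap.lsmul k A).compl₁₂ f.ofConv (D.smashToHom z)) (Coalgebra.comul c) := by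
  induction z with
  | zero =>
    simp only [map_zero, LinearMap.zero_apply]
    generalize Coalgebra.comul (R := k) c = v
    induction v with
    | zero => simp
    | add s s' hs hs' => rw [map_add, ← hs, ← hs', add_zero]
    | tmul x y => simp
  | add s s' hs hs' =>
    simp only [map_add, LinearMap.add_apply, hs, hs']
    generalize Coalgebra.comul (R := k) c = v
    clear hs hs'
    induction v with
    | zero => simp
    | add s s' hs hs' => simp only [map_add, ← hs, ← hs']; abel
    | tmul x y => simp
  | tmul b d =>
    rw [convMulLeft_tmul, smashToHom_tmul, LinearMap.convMul_apply]
    generalize Coalgebra.comul (R := k) c = v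
    induction v with
    | zero => simp
    | add s s' hs hs' => simp only [map_add, add_smul, hs, hs']
    | tmul x y => simpa [smashToHom_tmul, mul_smul] using smul_comm _ _ _

theorem smashToHom_mul (x y : A ⊗[k] ConvDual k C) :
    D.smashToHom (D.smashMul x y) = D.kmul (D.smashToHom x) (D.smashToHom y) := by
  induction x with
  | zero => simp only [map_zero, LinearMap.zero_apply, zero_kmul]
  | add s s' hs hs' => simp only [map_add, LinearMap.add_apply, hs, hs', add_kmul]
  | tmul a f =>
    induction y with
    | zero => simp only [map_zero, kmul_zero]
    | add s s' hs hs' => simp only [map_add, hs, hs', kmul_add]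
    | tmul b d =>
      ext c
      rw [smashMul_tmul, smashToHom_convMulLeft, kmul, spread, LinearMap.comp_apply,
        LinearMap.comp_apply]
      generalize Coalgebra.comul (R := k) c = v
      induction v with
      | zero => simp
      | add s s' hs hs' => simp only [map_add, hs, hs']
      | tmul x y =>
        simp only [TensorProduct.lift.tmul, LinearMap.compl₁₂_apply, LinearMap.lsmul_apply,
          LinearMap.comp_apply, smashToHom_tmul, map_smul, LinearMap.smul_apply]
        congr 1
        simp only [twist, LinearMap.mk₂_apply]
        generalize D.coactA a = t
        induction t with
        | zero => simp
        | add s s' hs hs' => simp only [map_add, LinearMap.add_apply, hs, hs']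
        | tmul h x => simp [contract, smashToHom_tmul, dualAct_apply]

/-- The algebra map `i : A # C* → #(C, A)`, `i(a # c*)(c) = ⟨c*, c⟩ a`. -/
def smashToKoppinen : D.Smash →ₐ[k] D.Koppinen :=
  AlgHom.ofLinearMap (D.smashToHom : A ⊗[k] ConvDual k C →ₗ[k] C →ₗ[k] A)
    (LinearMap.ext fun c => by
      change D.smashToHom ((1 : A) ⊗ₜ[k] (1 : ConvDual k C)) c = D.kone c
      simp [smashToHom_tmul, kone, Algebra.algebraMap_eq_smul_one])
    D.smashToHom_mul

/-- The algebra map `i_A : A → A # C*`, `i_A(a) = a # ε`. -/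
def inclA : A →ₐ[k] D.Smash :=
  AlgHom.ofLinearMap ((TensorProduct.mk k A (ConvDual k C)).flip 1) rfl (fun a b => by
    change (a * b) ⊗ₜ[k] (1 : ConvDual k C) = D.smashMul (a ⊗ₜ 1) (b ⊗ₜ 1)
    rw [smashMul_tmul]
    have h := D.isLeftCoaction_coactA.counit a
    simp only [AlgHom.toLinearMap_apply] at h
    conv_lhs => rw [← h]
    generalize D.coactA a = t
    induction t with
    | zero => simp
    | add s s' hs hs' => simp only [map_add, LinearMap.add_apply, add_mul, hs, hs', add_tmul]
    | tmul h x => simp [D.dualAct_conv_one, smul_tmul])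

/-- The algebra map `A → #(C, A)`, `a ↦ i(a # ε)`, that makes `#(C, A)` an `A`-bimodule. -/
def koppinenA : A →ₐ[k] D.Koppinen := D.smashToKoppinen.comp D.inclA

theorem koppinenA_mul_apply (a : A) (f : D.Koppinen) (c : C) :
    (D.koppinenA a * f) c = D.contract f (D.twist a c) := by
  have h2 := congrArg (fun z => D.contract f (D.twist a (TensorProduct.lid k C z)))
      (Coalgebra.rTensor_counit_comul (R := k) c)
  simp only [TensorProduct.lid_tmul, one_smul] at h2
  refine Eq.trans ?_ h2
  change D.contract f (TensorProduct.lift (D.twist ∘ₗ D.smashToHom (a ⊗ₜ[k] 1))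
    (Coalgebra.comul (R := k) c)) = _
  generalize Coalgebra.comul (R := k) c = v
  induction v with
  | zero => simp
  | add s s' hs hs' => simp only [map_add, hs, hs']
  | tmul x y => simp [smashToHom_tmul]

theorem mul_koppinenA_apply (a : A) (f : D.Koppinen) (c : C) :
    (f * D.koppinenA a) c = f c * a := by
  have h : D.contract (D.koppinenA a) = (LinearMap.mulRight k a) ∘ₗ D.indCounit A := by
    refine TensorProduct.ext' fun c b => ?_
    change b * D.smashToHom (a ⊗ₜ[k] 1) c =
      TensorProduct.lid k A ((Coalgebra.counit (R := k) (A := C)).rTensor A (c ⊗ₜ[k] b)) * a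
    simp [smashToHom_tmul]
  have h3 : D.indCounit A (D.spread f c) = f c := by
    have h1 := D.kmul_kone f
    have h4 := (D.contract_eq D.kone (D.spread f c)).trans (congrArg (D.indCounit A)
      (tri_kone (D.isDoiHopfCoaction_indCoact A) (D.spread f c : D.Ind A)))
    rw [← h4]
    exact LinearMap.congr_fun h1 c
  exact (LinearMap.congr_fun h (D.spread f c)).trans (congrArg (· * a) h3)

section SmashAct

variable {M : Type*} [AddCommGroup M] [Module k M] [Module Aᵐᵒᵖ M] [IsScalarTower k Aᵐᵒᵖ M]

/-- The right action `m · (a # c*) = ∑ ⟨c*, m₍₋₁₎⟩ m₍₀₎ a` of `A # C*`. -/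
def smashAct (ρ : M →ₗ[k] C ⊗[k] M) : D.Smash →ₗ[k] M →ₗ[k] M :=
  (TensorProduct.lift (LinearMap.mk₂ k
    (fun a (f : ConvDual k C) => rightAct k A M a ∘ₗ (TensorProduct.lid k M).toLinearMap ∘ₗ
      f.ofConv.rTensor M ∘ₗ ρ)
    (fun a b f => by rw [map_add, LinearMap.add_comp])
    (fun r a f => by rw [map_smul, LinearMap.smul_comp])
    (fun a f g => by
      rw [WithConv.ofConv_add, LinearMap.rTensor_add, LinearMap.add_comp, LinearMap.comp_add,
        LinearMap.comp_add])
    (fun r a f => by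
      rw [WithConv.ofConv_smul, LinearMap.rTensor_smul, LinearMap.smul_comp, LinearMap.comp_smul,
        LinearMap.comp_smul])) : A ⊗[k] ConvDual k C →ₗ[k] M →ₗ[k] M)

theorem smashAct_smash (ρ : M →ₗ[k] C ⊗[k] M) (a : A) (f : ConvDual k C) (m : M) :
    D.smashAct ρ (D.smash a f) m =
      op a • TensorProduct.lid k M (f.ofConv.rTensor M (ρ m)) := rfl

theorem smashAct_eq_tri (ρ : M →ₗ[k] C ⊗[k] M) (s : D.Smash) (m : M) :
    D.smashAct ρ s m = D.tri ρ (D.smashToKoppinen s) m := by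
  have key : ∀ s : A ⊗[k] ConvDual k C, D.smashAct ρ s m = D.tri ρ (D.smashToHom s) m := by
    intro s
    induction s with
    | zero =>
      rw [map_zero]
      refine (LinearMap.congr_fun (map_zero (D.smashAct ρ)) m).trans ?_
      have h := LinearMap.congr_fun (D.tri_smul M ρ 0 0) m
      simpa using h.symm
    | add s s' hs hs' =>
      rw [map_add, tri_add, LinearMap.add_apply, ← hs, ← hs']
      exact LinearMap.congr_fun (map_add (D.smashAct ρ) s s') m
    | tmul a f =>
      refine (D.smashAct_smash ρ a f m).trans ?_
      simp only [tri, LinearMap.comp_apply]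
      generalize ρ m = t
      induction t with
      | zero => simp
      | add s s' hs hs' => simp only [map_add, smul_add, hs, hs']
      | tmul c z => simpa [smashToHom_tmul] using smul_comm _ _ _
  exact key s

end SmashAct

/-! ### The category of Doi-Hopf modules and the adjoint pair `(F, G)` -/

/-- Right-left Doi-Hopf modules. -/
structure DoiHopfModule where
  carrier : Type u
  [addCommGroup : AddCommGroup carrier]
  [module : Module k carrier]
  [moduleA : Module Aᵐᵒᵖ carrier]
  [isScalarTower : IsScalarTower k Aᵐᵒᵖ carrier]
  coact : carrier →ₗ[k] C ⊗[k] carrier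
  isDoiHopfCoaction : D.IsDoiHopfCoaction coact

attribute [instance] DoiHopfModule.addCommGroup DoiHopfModule.module DoiHopfModule.moduleA
  DoiHopfModule.isScalarTower

namespace DoiHopfModule

variable {D}

/-- A morphism of Doi-Hopf modules: an `A`-linear map that is `C`-colinear. -/
@[ext]
structure Hom (M N : D.DoiHopfModule) where
  hom : M.carrier →ₗ[Aᵐᵒᵖ] N.carrier
  colinear : ∀ m, N.coact (hom m) = (hom.restrictScalars k).lTensor C (M.coact m)

instance : Category D.DoiHopfModule where
  Hom := Hom
  id M := ⟨LinearMap.id, fun m => (LinearMap.congr_fun (LinearMap.lTensor_id C M.carrier) _).symm⟩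
  comp f g := ⟨g.hom ∘ₗ f.hom, fun m => by
    rw [LinearMap.comp_apply, g.colinear, f.colinear]
    exact (LinearMap.lTensor_comp_apply C (g.hom.restrictScalars k) (f.hom.restrictScalars k)
      _).symm⟩

@[ext]
theorem hom_ext {M N : D.DoiHopfModule} {f g : M ⟶ N} (h : ∀ m, f.hom m = g.hom m) : f = g :=
  Hom.ext (LinearMap.ext h)

@[simp]
theorem id_hom (M : D.DoiHopfModule) : Hom.hom (𝟙 M) = LinearMap.id := rfl

@[simp]
theorem comp_hom {M N L : D.DoiHopfModule} (f : M ⟶ N) (g : N ⟶ L) :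
    (f ≫ g).hom = g.hom ∘ₗ f.hom := rfl

end DoiHopfModule

/-- The functor forgetting the `C`-coaction. -/
def F : D.DoiHopfModule ⥤ ModuleCat.{u} Aᵐᵒᵖ where
  obj M := ModuleCat.of Aᵐᵒᵖ M.carrier
  map f := ModuleCat.ofHom f.hom

theorem lTensor_diagAct {M N : Type*} [AddCommGroup M] [Module k M] [Module Aᵐᵒᵖ M]
    [IsScalarTower k Aᵐᵒᵖ M] [AddCommGroup N] [Module k N] [Module Aᵐᵒᵖ N]
    [IsScalarTower k Aᵐᵒᵖ N] (f : M →ₗ[k] N) (hf : ∀ (a : A) m, f (op a • m) = op a • f m)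
    (t : H ⊗[k] A) (x : C ⊗[k] M) :
    f.lTensor C (diagAct k H A C M t x) = diagAct k H A C N t (f.lTensor C x) := by
  induction t with
  | zero => simp
  | add s s' hs hs' => simp only [map_add, LinearMap.add_apply, hs, hs']
  | tmul h b =>
    induction x with
    | zero => simp
    | add s s' hs hs' => simp only [map_add, hs, hs']
    | tmul c z => simp [hf]

/-- For an `A`-linear map `f`, the `A`-linear map `c ⊗ m ↦ c ⊗ f(m)`. -/
def indMap {M N : Type*} [AddCommGroup M] [Module k M] [Module Aᵐᵒᵖ M] [IsScalarTower k Aᵐᵒᵖ M]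
    [AddCommGroup N] [Module k N] [Module Aᵐᵒᵖ N] [IsScalarTower k Aᵐᵒᵖ N]
    (f : M →ₗ[Aᵐᵒᵖ] N) : D.Ind M →ₗ[Aᵐᵒᵖ] D.Ind N where
  toFun := ((f.restrictScalars k).lTensor C : C ⊗[k] M →ₗ[k] C ⊗[k] N)
  map_add' := map_add ((f.restrictScalars k).lTensor C : C ⊗[k] M →ₗ[k] C ⊗[k] N)
  map_smul' a x := lTensor_diagAct (f.restrictScalars k) (fun b m => f.map_smul (op b) m)
    (D.coactA a.unop) x

theorem indMap_tmul {M N : Type*} [AddCommGroup M] [Module k M] [Module Aᵐᵒᵖ M]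
    [IsScalarTower k Aᵐᵒᵖ M] [AddCommGroup N] [Module k N] [Module Aᵐᵒᵖ N]
    [IsScalarTower k Aᵐᵒᵖ N] (f : M →ₗ[Aᵐᵒᵖ] N) (c : C) (m : M) :
    D.indMap f (D.tmul c m) = D.tmul c (f m) := rfl

theorem indCoact_map {M N : Type*} [AddCommGroup M] [Module k M] [AddCommGroup N] [Module k N]
    (f : M →ₗ[k] N) (x : C ⊗[k] M) :
    TensorProduct.assoc k C C N ((Coalgebra.comul (R := k) (A := C)).rTensor N (f.lTensor C x)) =
      (f.lTensor C).lTensor C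
        (TensorProduct.assoc k C C M ((Coalgebra.comul (R := k) (A := C)).rTensor M x)) := by
  induction x with
  | zero => simp
  | add s s' hs hs' => simp only [map_add, hs, hs']
  | tmul c z =>
    simp only [LinearMap.lTensor_tmul, LinearMap.rTensor_tmul]
    generalize Coalgebra.comul (R := k) c = v
    induction v with
    | zero => simp
    | add s s' hs hs' => simp only [map_add, add_tmul, hs, hs']
    | tmul x y => simp

/-- The induction functor `G(N) = C ⊗ N`. -/
def G : ModuleCat.{u} Aᵐᵒᵖ ⥤ D.DoiHopfModule where
  obj N :=
    { carrier := D.Ind N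
      coact := D.indCoact N
      isDoiHopfCoaction := D.isDoiHopfCoaction_indCoact N }
  map f :=
    { hom := D.indMap f.hom
      colinear := indCoact_map (f.hom.restrictScalars k) }
  map_id N := DoiHopfModule.hom_ext fun x =>
    LinearMap.congr_fun (LinearMap.lTensor_id C N) x
  map_comp f g := DoiHopfModule.hom_ext fun x =>
    LinearMap.lTensor_comp_apply C (g.hom.restrictScalars k) (f.hom.restrictScalars k) x

/-- The identity of a Doi-Hopf module `M`, with values in the right `A`-module `F(M)`. -/
def toF (M : D.DoiHopfModule) : M.carrier →ₗ[k] D.F.obj M where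
  toFun m := m
  map_add' _ _ := rfl
  map_smul' r m := algebra_compatible_smul Aᵐᵒᵖ r m

theorem toF_diagAct (M : D.DoiHopfModule) (a : A) (m : M.carrier) :
    (D.toF M).lTensor C (M.coact (op a • m)) =
      diagAct k H A C (D.F.obj M) (D.coactA a) ((D.toF M).lTensor C (M.coact m)) := by
  rw [M.isDoiHopfCoaction.compat]
  apply lTensor_diagAct
  intros
  rfl

/-- The component `m ↦ ∑ m₍₋₁₎ ⊗ m₍₀₎` at `M` of the unit `ρ : 1 ⟶ G F`. -/
def unitApp (M : D.DoiHopfModule) : M ⟶ D.G.obj (D.F.obj M) where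
  hom :=
    { toFun m := ((D.toF M).lTensor C (M.coact m) : C ⊗[k] D.F.obj M)
      map_add' m n := by rw [map_add, map_add]; rfl
      map_smul' a m := D.toF_diagAct M a.unop m }
  colinear m := by
    refine (indCoact_map (D.toF M) (M.coact m)).trans ?_
    rw [M.isDoiHopfCoaction.isLeftCoaction.coassoc]
    exact (LinearMap.lTensor_comp_apply C ((D.toF M).lTensor C) M.coact (M.coact m)).symm

theorem unitApp_naturality {M N : D.DoiHopfModule} (f : M ⟶ N) (m : M.carrier) :
    (D.toF N).lTensor C (N.coact (f.hom m)) =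
      ((D.F.map f).hom.restrictScalars k).lTensor C ((D.toF M).lTensor C (M.coact m)) := by
  rw [f.colinear, ← LinearMap.lTensor_comp_apply, ← LinearMap.lTensor_comp_apply]
  rfl

theorem counit_unitApp (M : D.DoiHopfModule) (m : M.carrier) :
    D.indCounit (D.F.obj M) ((D.toF M).lTensor C (M.coact m)) = D.toF M m := by
  conv_rhs => rw [← M.isDoiHopfCoaction.isLeftCoaction.counit m]
  change TensorProduct.lid k (D.F.obj M) ((Coalgebra.counit (R := k) (A := C)).rTensor
    (D.F.obj M) ((D.toF M).lTensor C (M.coact m))) = _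
  generalize M.coact m = t
  induction t with
  | zero => simp
  | add s s' hs hs' => simp only [map_add, hs, hs']
  | tmul c z => simp

/-- The component `c ⊗ n ↦ ε(c) n` at `N` of the counit `F G ⟶ 1`. -/
def counitApp (N : ModuleCat.{u} Aᵐᵒᵖ) : D.F.obj (D.G.obj N) ⟶ N :=
  ModuleCat.ofHom (X := D.Ind N)
    { toFun := D.indCounit N
      map_add' := map_add (D.indCounit N)
      map_smul' a x := D.indCounit_smul a.unop x }

theorem counitApp_unitApp (N : ModuleCat.{u} Aᵐᵒᵖ) (x : C ⊗[k] N) :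
    ((D.counitApp N).hom.restrictScalars k).lTensor C
      ((D.toF (D.G.obj N)).lTensor C (D.indCoact N x)) = x := by
  let T : D.Ind N →ₗ[k] N := (D.counitApp N).hom.restrictScalars k ∘ₗ D.toF (D.G.obj N)
  have hT : T = D.indCounit N := rfl
  refine (LinearMap.lTensor_comp_apply C ((D.counitApp N).hom.restrictScalars k)
    (D.toF (D.G.obj N)) (D.indCoact N x)).symm.trans ?_
  change (D.indCounit N).lTensor C (D.indCoact N x) = x
  let T' : C ⊗[k] N →ₗ[k] N :=
    (TensorProduct.lid k N).toLinearMap ∘ₗ (Coalgebra.counit (R := k) (A := C)).rTensor N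
  change T'.lTensor C (TensorProduct.assoc k C C N
    ((Coalgebra.comul (R := k) (A := C)).rTensor N x)) = x
  induction x with
  | zero => simp
  | add s s' hs hs' => simp only [map_add, hs, hs']
  | tmul c n =>
    have h2 := congrArg (fun z => (TensorProduct.rid k C z) ⊗ₜ[k] n)
      (Coalgebra.lTensor_counit_comul (R := k) c)
    simp only [TensorProduct.rid_tmul, one_smul] at h2
    rw [LinearMap.rTensor_tmul]
    refine Eq.trans ?_ h2
    generalize Coalgebra.comul (R := k) c = v
    induction v with
    | zero => simp
    | add s s' hs hs' => simp only [map_add, add_tmul, hs, hs']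
    | tmul x y => simp [T', smul_tmul]

/-- The adjunction between the forgetful functor `F` and the induction functor `G`. Its unit is
the coaction, and its counit is `c ⊗ n ↦ ε(c) n`. -/
def adj : D.F ⊣ D.G :=
  Adjunction.mkOfUnitCounit
    { unit :=
        { app := D.unitApp
          naturality _ _ f := DoiHopfModule.hom_ext (D.unitApp_naturality f) }
      counit :=
        { app := D.counitApp
          naturality N L f := by
            ext x
            change D.indCounit L (D.indMap f.hom x) = f.hom (D.indCounit N x)
            change C ⊗[k] N at x
            induction x with
            | zero =>
              exact (((D.indCounit L) ∘ₗ (D.indMap f.hom).restrictScalars k).map_zero).trans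
                (((f.hom.restrictScalars k) ∘ₗ (D.indCounit N)).map_zero).symm
            | add s s' hs hs' =>
              exact (((D.indCounit L) ∘ₗ (D.indMap f.hom).restrictScalars k).map_add s s').trans
                ((congrArg₂ (· + ·) hs hs').trans
                (((f.hom.restrictScalars k) ∘ₗ (D.indCounit N)).map_add s s').symm)
            | tmul c n =>
              change Coalgebra.counit (R := k) c • f.hom n =
                (f.hom.restrictScalars k) (Coalgebra.counit (R := k) c • n)
              rw [map_smul]
              rfl }
      left_triangle := by
        ext M m
        exact D.counit_unitApp M m
      right_triangle := by
        ext N x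
        exact D.counitApp_unitApp N x }

/-! ### The functors `P` and `T` and the natural transformation `χ` -/

/-- The right `A # C*`-module structure `m · (a # c*) = ∑ ⟨c*, m₍₋₁₎⟩ m₍₀₎ a` of a Doi-Hopf
module. -/
instance (M : D.DoiHopfModule) : Module D.Smashᵐᵒᵖ M.carrier where
  smul s m := D.smashAct M.coact (unop s) m
  one_smul m := by
    change D.smashAct M.coact 1 m = m
    rw [smashAct_eq_tri, map_one]
    exact tri_kone M.isDoiHopfCoaction m
  mul_smul s t m := by
    change D.smashAct M.coact (unop t * unop s) m =
      D.smashAct M.coact (unop s) (D.smashAct M.coact (unop t) m)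
    rw [smashAct_eq_tri, smashAct_eq_tri, smashAct_eq_tri, map_mul]
    exact tri_kmul M.isDoiHopfCoaction _ _ m
  smul_zero s := map_zero (D.smashAct M.coact (unop s))
  smul_add s := map_add (D.smashAct M.coact (unop s))
  add_smul s t m := LinearMap.congr_fun (map_add (D.smashAct M.coact) (unop s) (unop t)) m
  zero_smul m := LinearMap.congr_fun (map_zero (D.smashAct M.coact)) m

theorem op_smul_eq_smashAct (M : D.DoiHopfModule) (s : D.Smash) (m : M.carrier) :
    op s • m = D.smashAct M.coact s m := rfl

variable {D} in
theorem DoiHopfModule.hom_tri {M N : D.DoiHopfModule} (f : M ⟶ N) (g : C →ₗ[k] A)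
    (m : M.carrier) : f.hom (D.tri M.coact g m) = D.tri N.coact g (f.hom m) := by
  simp only [tri, LinearMap.comp_apply]
  rw [f.colinear]
  generalize M.coact m = t
  induction t with
  | zero => simp
  | add s s' hs hs' => simp only [map_add, hs, hs']
  | tmul c z => simp

/-- The functor `P` from Doi-Hopf modules to right `A # C*`-modules. -/
def P : D.DoiHopfModule ⥤ ModuleCat.{u} D.Smashᵐᵒᵖ where
  obj M := ModuleCat.of D.Smashᵐᵒᵖ M.carrier
  map {M N} f := ModuleCat.ofHom
    { toFun := f.hom
      map_add' := map_add f.hom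
      map_smul' s m := by
        change f.hom (D.smashAct M.coact (unop s) m) = D.smashAct N.coact (unop s) (f.hom m)
        rw [smashAct_eq_tri, smashAct_eq_tri]
        exact DoiHopfModule.hom_tri f _ m }

section ExtK

variable (N : Type*) [AddCommGroup N] [Module k N] [Module Aᵐᵒᵖ N]

/-- The relations `n a ⊗ f - n ⊗ a f` that define `N ⊗_A #(C, A)`. -/
def balanced : Submodule k (N ⊗[k] D.Koppinen) :=
  Submodule.span k {z | ∃ (n : N) (a : A) (f : D.Koppinen),
    z = (op a • n) ⊗ₜ[k] f - n ⊗ₜ[k] (D.koppinenA a * f)}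

/-- The tensor product `N ⊗_A #(C, A)`. -/
def TensorK : Type _ := (N ⊗[k] D.Koppinen) ⧸ D.balanced N

instance : AddCommGroup (D.TensorK N) :=
  inferInstanceAs (AddCommGroup ((N ⊗[k] D.Koppinen) ⧸ D.balanced N))
instance : Module k (D.TensorK N) :=
  inferInstanceAs (Module k ((N ⊗[k] D.Koppinen) ⧸ D.balanced N))

/-- The projection from `N ⊗ #(C, A)` to `N ⊗_A #(C, A)`. -/
def mkK : N ⊗[k] D.Koppinen →ₗ[k] D.TensorK N := (D.balanced N).mkQ

theorem mkK_surjective : Function.Surjective (D.mkK N) := Submodule.mkQ_surjective _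

variable {N} in
/-- The element `n ⊗ f` of `N ⊗_A #(C, A)`. -/
def tmulK (n : N) (f : D.Koppinen) : D.TensorK N := D.mkK N (n ⊗ₜ f)

theorem tmulK_balanced (n : N) (a : A) (f : D.Koppinen) :
    D.tmulK (op a • n) f = D.tmulK n (D.koppinenA a * f) := by
  refine sub_eq_zero.mp ?_
  rw [tmulK, tmulK, ← map_sub]
  exact (Submodule.Quotient.mk_eq_zero _).mpr (Submodule.subset_span ⟨n, a, f, rfl⟩)

variable {N} in
/-- Linear maps on `N ⊗_A #(C, A)` from balanced linear maps on `N ⊗ #(C, A)`. -/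
def liftK {X : Type*} [AddCommGroup X] [Module k X] (L : N ⊗[k] D.Koppinen →ₗ[k] X)
    (hL : ∀ n a f, L ((op a • n) ⊗ₜ f) = L (n ⊗ₜ (D.koppinenA a * f))) : D.TensorK N →ₗ[k] X :=
  (D.balanced N).liftQ L (Submodule.span_le.mpr (by
    rintro z ⟨n, a, f, rfl⟩
    exact LinearMap.mem_ker.mpr (by rw [map_sub, hL, sub_self])))

/-- The right action `(n ⊗ f) · g = n ⊗ (f • g)` of `#(C, A)`. -/
def actK (g : D.Koppinen) : D.TensorK N →ₗ[k] D.TensorK N :=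
  D.liftK (D.mkK N ∘ₗ (LinearMap.mulRight k g).lTensor N) (fun n a f => by
    simp only [LinearMap.comp_apply, LinearMap.lTensor_tmul, LinearMap.mulRight_apply]
    rw [mul_assoc]
    exact D.tmulK_balanced N n a (f * g))

theorem actK_tmulK (g f : D.Koppinen) (n : N) :
    D.actK N g (D.tmulK n f) = D.tmulK n (f * g) := rfl

theorem hom_ext_K {X : Type*} [AddCommGroup X] {L L' : D.TensorK N →+ X}
    (h : ∀ n f, L (D.tmulK n f) = L' (D.tmulK n f)) : L = L' := by
  ext z
  obtain ⟨z, rfl⟩ := D.mkK_surjective N z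
  induction z with
  | zero => simp
  | add s s' hs hs' => simp only [map_add, hs, hs']
  | tmul n f => exact h n f

theorem hom_congr_K {X : Type*} [AddCommGroup X] (L L' : D.TensorK N →+ X)
    (h : ∀ n f, L (D.tmulK n f) = L' (D.tmulK n f)) (x : D.TensorK N) : L x = L' x := by
  rw [D.hom_ext_K N h]

theorem tmulK_add (n : N) (f g : D.Koppinen) :
    D.tmulK n (f + g) = D.tmulK n f + D.tmulK n g := by
  rw [tmulK, tmul_add, map_add]; rfl

theorem add_tmulK (n n' : N) (f : D.Koppinen) :
    D.tmulK (n + n') f = D.tmulK n f + D.tmulK n' f := by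
  rw [tmulK, add_tmul, map_add]; rfl

theorem tmulK_zero (n : N) : D.tmulK n 0 = 0 := by
  rw [tmulK, tmul_zero, map_zero]

/-- The right `#(C, A)`-module structure of `N ⊗_A #(C, A)`. -/
instance : Module D.Koppinenᵐᵒᵖ (D.TensorK N) where
  smul g x := D.actK N (unop g) x
  one_smul := D.hom_congr_K N (D.actK N 1).toAddMonoidHom (AddMonoidHom.id _) (fun n f => by
    change D.tmulK n (f * 1) = _
    rw [mul_one]; rfl)
  mul_smul g g' := D.hom_congr_K N (D.actK N (unop g' * unop g)).toAddMonoidHom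
    (D.actK N (unop g) ∘ₗ D.actK N (unop g')).toAddMonoidHom (fun n f => by
      change D.tmulK n (f * (unop g' * unop g)) = D.tmulK n (f * unop g' * unop g)
      rw [mul_assoc])
  smul_zero g := map_zero (D.actK N (unop g))
  smul_add g := map_add (D.actK N (unop g))
  add_smul g g' := D.hom_congr_K N (D.actK N (unop g + unop g')).toAddMonoidHom
    (D.actK N (unop g) + D.actK N (unop g')).toAddMonoidHom (fun n f => by
      change D.tmulK n (f * (unop g + unop g')) =
        D.tmulK n (f * unop g) + D.tmulK n (f * unop g')
      rw [mul_add, tmulK_add])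
  zero_smul := D.hom_congr_K N (D.actK N 0).toAddMonoidHom 0 (fun n f => by
    change D.tmulK n (f * 0) = 0
    rw [mul_zero, tmulK_zero])

theorem op_smul_tmulK (g f : D.Koppinen) (n : N) :
    op g • D.tmulK n f = D.tmulK n (f * g) := rfl

end ExtK

/-- For an `A`-linear map `φ`, the `#(C, A)`-linear map `n ⊗ f ↦ φ(n) ⊗ f`. -/
def mapK {N N' : Type*} [AddCommGroup N] [Module k N] [Module Aᵐᵒᵖ N] [IsScalarTower k Aᵐᵒᵖ N]
    [AddCommGroup N'] [Module k N'] [Module Aᵐᵒᵖ N'] [IsScalarTower k Aᵐᵒᵖ N']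
    (φ : N →ₗ[Aᵐᵒᵖ] N') : D.TensorK N →ₗ[D.Koppinenᵐᵒᵖ] D.TensorK N' :=
  let L : D.TensorK N →ₗ[k] D.TensorK N' :=
    D.liftK (D.mkK N' ∘ₗ (φ.restrictScalars k).rTensor D.Koppinen) (fun n a f => by
      simp only [LinearMap.comp_apply, LinearMap.rTensor_tmul, LinearMap.restrictScalars_apply,
        map_smul]
      exact D.tmulK_balanced N' (φ n) a f)
  { toFun := L
    map_add' := map_add L
    map_smul' g := D.hom_congr_K N (L ∘ₗ D.actK N (unop g)).toAddMonoidHom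
      (D.actK N' (unop g) ∘ₗ L).toAddMonoidHom (fun n f => rfl) }

theorem mapK_tmulK {N N' : Type*} [AddCommGroup N] [Module k N] [Module Aᵐᵒᵖ N]
    [IsScalarTower k Aᵐᵒᵖ N] [AddCommGroup N'] [Module k N'] [Module Aᵐᵒᵖ N']
    [IsScalarTower k Aᵐᵒᵖ N'] (φ : N →ₗ[Aᵐᵒᵖ] N') (n : N) (f : D.Koppinen) :
    D.mapK φ (D.tmulK n f) = D.tmulK (φ n) f := rfl

/-- The functor `N ↦ N ⊗_A #(C, A)` from right `A`-modules to right `#(C, A)`-modules. -/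
def extK : ModuleCat.{u} Aᵐᵒᵖ ⥤ ModuleCat.{u} D.Koppinenᵐᵒᵖ where
  obj N := ModuleCat.of D.Koppinenᵐᵒᵖ (D.TensorK N)
  map f := ModuleCat.ofHom (D.mapK f.hom)
  map_id N := ModuleCat.hom_ext (LinearMap.ext
    (D.hom_congr_K N (D.mapK LinearMap.id).toAddMonoidHom (AddMonoidHom.id _) (fun _ _ => rfl)))
  map_comp {N _ _} f g := ModuleCat.hom_ext (LinearMap.ext
    (D.hom_congr_K N (D.mapK (g.hom ∘ₗ f.hom)).toAddMonoidHom
      (D.mapK g.hom ∘ₗ D.mapK f.hom).toAddMonoidHom (fun _ _ => rfl)))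

/-- The functor `T`: `N ↦ N ⊗_A #(C, A)` followed by restriction of scalars along
`i : A # C* → #(C, A)`. -/
def T : ModuleCat.{u} Aᵐᵒᵖ ⥤ ModuleCat.{u} D.Smashᵐᵒᵖ :=
  D.extK ⋙ ModuleCat.restrictScalars (RingHom.op (D.smashToKoppinen : D.Smash →+* D.Koppinen))

/-- The map `F(M) → M` inverse to `toF`. -/
def ofF (M : D.DoiHopfModule) : D.F.obj M →ₗ[k] M.carrier where
  toFun m := m
  map_add' _ _ := rfl
  map_smul' r m := (algebra_compatible_smul Aᵐᵒᵖ r (show M.carrier from m)).symm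

/-- The bilinear map `(m, f) ↦ m ◁ f = ∑ m₍₀₎ f(m₍₋₁₎)`. -/
def chiBilin (M : D.DoiHopfModule) : D.F.obj M →ₗ[k] D.Koppinen →ₗ[k] M.carrier :=
  LinearMap.mk₂ k (fun m f => D.tri M.coact f (D.ofF M m))
    (fun m n f => by rw [map_add, map_add]) (fun r m f => by rw [map_smul, map_smul])
    (fun m f g => LinearMap.congr_fun (D.tri_add M.carrier M.coact f g) _)
    (fun r m f => LinearMap.congr_fun (D.tri_smul M.carrier M.coact r f) _)

theorem tri_op_smul (M : D.DoiHopfModule) (m : M.carrier) (a : A) (f : D.Koppinen) :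
    D.tri M.coact f (op a • m) = D.tri M.coact (D.koppinenA a * f : D.Koppinen) m := by
  have h := tri_kmul M.isDoiHopfCoaction (D.koppinenA a) f m
  refine Eq.trans (congrArg _ ?_) h.symm
  conv_lhs => rw [← M.isDoiHopfCoaction.isLeftCoaction.counit m]
  simp only [tri, LinearMap.comp_apply]
  generalize M.coact m = t
  induction t with
  | zero => simp
  | add s s' hs hs' => simp only [map_add, smul_add, hs, hs']
  | tmul c z =>
    change op a • (Coalgebra.counit (R := k) c • z) =
      op (D.smashToHom (a ⊗ₜ[k] (1 : ConvDual k C)) c) • z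
    rw [smashToHom_tmul, smul_comm, LinearMap.convOne_apply, Algebra.algebraMap_self_apply,
      MulOpposite.op_smul, smul_assoc]

/-- The component `m ⊗ f ↦ m ◁ f = ∑ m₍₀₎ f(m₍₋₁₎)` of `χ` at the Doi-Hopf module `M`. -/
def chiLin (M : D.DoiHopfModule) : D.TensorK (D.F.obj M) →ₗ[k] M.carrier :=
  D.liftK (TensorProduct.lift (D.chiBilin M)) (fun n a f => D.tri_op_smul M n a f)

theorem chiLin_tmulK (M : D.DoiHopfModule) (m : D.F.obj M) (f : D.Koppinen) :
    D.chiLin M (D.tmulK m f) = D.tri M.coact f (D.ofF M m) := rfl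

/-- The component of `χ` at `M`, as a map of right `A # C*`-modules. -/
def chiApp (M : D.DoiHopfModule) : D.T.obj (D.F.obj M) ⟶ D.P.obj M :=
  ModuleCat.ofHom (X := D.T.obj (D.F.obj M)) (Y := M.carrier)
    { toFun := D.chiLin M
      map_add' := map_add (D.chiLin M)
      map_smul' s := D.hom_congr_K (D.F.obj M)
        (D.chiLin M ∘ₗ D.actK (D.F.obj M) (D.smashToKoppinen (unop s))).toAddMonoidHom
        (D.smashAct M.coact (unop s) ∘ₗ D.chiLin M).toAddMonoidHom (fun m f => by
          refine (tri_kmul M.isDoiHopfCoaction f (D.smashToKoppinen (unop s)) _).trans ?_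
          exact (D.smashAct_eq_tri M.coact (unop s) _).symm) }

/-- The natural transformation `χ : T F ⟶ P`, `χ_M(m ⊗ f) = m ◁ f`. -/
def chi : D.F ⋙ D.T ⟶ D.P where
  app := D.chiApp
  naturality M N f := ModuleCat.hom_ext (LinearMap.ext
    (D.hom_congr_K (D.F.obj M)
      ((D.chiApp N).hom.toAddMonoidHom.comp (D.T.map (D.F.map f)).hom.toAddMonoidHom)
      ((D.P.map f).hom.toAddMonoidHom.comp (D.chiApp M).hom.toAddMonoidHom)
      (fun m g => (DoiHopfModule.hom_tri f g (D.ofF M m)).symm)))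

/-! ### The `k`-modules `V'`, `V'₅`, `V₁`, ..., `V₅` -/

/-- The `k`-module `V'` of natural transformations `P G ⟶ T`. -/
abbrev V' : Type _ := D.G ⋙ D.P ⟶ D.T

/-- The regular right `A`-module `A`. -/
def regular (_ : DoiHopfDatum k H A C) : ModuleCat.{u} Aᵐᵒᵖ := ModuleCat.of Aᵐᵒᵖ A

/-- An element of `A` as an element of the regular right module. -/
def toRegular (a : A) : D.regular := a

/-- The condition `χ ∘ φF ∘ Pρ = 1_P` on `φ : P G ⟶ T`. -/
def SplitsUnit (φ : D.V') : Prop := IsRelativeSplitting D.adj D.P D.T D.chi φ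

/-- The `k`-linear identification of `#(C, A)` with `Hom(C, A)`. -/
def toHom : D.Koppinen ≃ₗ[k] (C →ₗ[k] A) := LinearEquiv.refl k _

theorem toHom_apply (f : D.Koppinen) (c : C) : D.toHom f c = f c := rfl

/-- The left action `b (c ⊗ a) = c ⊗ b a` of `A` on `C ⊗ A`. -/
def leftMul : A →ₗ[k] D.Ind A →ₗ[k] D.Ind A :=
  (LinearMap.lTensorHom C ∘ₗ LinearMap.mul k A : A →ₗ[k] C ⊗[k] A →ₗ[k] C ⊗[k] A)

theorem leftMul_tmul (b a : A) (c : C) : D.leftMul b (D.tmul c a) = D.tmul c (b * a) := rfl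

/-- The inclusion `c ↦ c ⊗ 1` of `C` in `C ⊗ A`. -/
def inclC : C →ₗ[k] D.Ind A := ((TensorProduct.mk k C A).flip 1 : C →ₗ[k] C ⊗[k] A)

theorem inclC_apply (c : C) : D.inclC c = D.tmul c 1 := rfl

/-- The map `(c, x) ↦ c ⊗ x` as a bilinear map from `C × M` to `C ⊗ M`. -/
def mkInd (M : Type*) [AddCommGroup M] [Module k M] : C →ₗ[k] M →ₗ[k] D.Ind M :=
  TensorProduct.mk k C M

theorem mkInd_apply (M : Type*) [AddCommGroup M] [Module k M] (c : C) (m : M) :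
    D.mkInd M c m = D.tmul c m := rfl

/-- The element `∑ c · a₍₋₁₎ ⊗ a₍₀₎` acted upon: `∑ L(a₍₀₎, γ(c · a₍₋₁₎))`. -/
def sum₁ {X : Type*} [AddCommGroup X] [Module k X] (L : A →ₗ[k] X →ₗ[k] X) (γ : C →ₗ[k] X)
    (a : A) (c : C) : X :=
  TensorProduct.lift L.flip (γ.rTensor A (D.twist a c))

/-- `∑ c · a₍₋₂₎ ⊗ (d · a₍₋₁₎ ⊗ a₍₀₎)` in `C ⊗ (C ⊗ A)`. -/
def twist₂ (a : A) (c d : C) : C ⊗[k] (C ⊗[k] A) :=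
  TensorProduct.map ((rightAct k H C).flip c)
    (TensorProduct.map ((rightAct k H C).flip d) LinearMap.id)
    (D.coactA.toLinearMap.lTensor H (D.coactA a))

/-- `∑ L(a₍₀₎, Θ(c · a₍₋₂₎ ⊗ d · a₍₋₁₎))`. -/
def sum₂ {X : Type*} [AddCommGroup X] [Module k X] (L : A →ₗ[k] X →ₗ[k] X)
    (Θ : C ⊗[k] C →ₗ[k] X) (a : A) (c d : C) : X :=
  TensorProduct.lift L.flip
    (Θ.rTensor A ((TensorProduct.assoc k C C A).symm (D.twist₂ a c d)))

section Linear

variable {X : Type*} [AddCommGroup X] [Module k X] (L : A →ₗ[k] X →ₗ[k] X)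

theorem sum₁_add (γ γ' : C →ₗ[k] X) (a : A) (c : C) :
    D.sum₁ L (γ + γ') a c = D.sum₁ L γ a c + D.sum₁ L γ' a c := by
  simp [sum₁, LinearMap.rTensor_add]

theorem sum₁_smul (r : k) (γ : C →ₗ[k] X) (a : A) (c : C) :
    D.sum₁ L (r • γ) a c = r • D.sum₁ L γ a c := by
  simp [sum₁, LinearMap.rTensor_smul]

theorem sum₁_zero (a : A) (c : C) : D.sum₁ L 0 a c = 0 := by
  simp [sum₁]

theorem sum₂_add (Θ Θ' : C ⊗[k] C →ₗ[k] X) (a : A) (c d : C) :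
    D.sum₂ L (Θ + Θ') a c d = D.sum₂ L Θ a c d + D.sum₂ L Θ' a c d := by
  simp [sum₂, LinearMap.rTensor_add]

theorem sum₂_smul (r : k) (Θ : C ⊗[k] C →ₗ[k] X) (a : A) (c d : C) :
    D.sum₂ L (r • Θ) a c d = r • D.sum₂ L Θ a c d := by
  simp [sum₂, LinearMap.rTensor_smul]

theorem sum₂_zero (a : A) (c d : C) : D.sum₂ L 0 a c d = 0 := by
  simp [sum₂]

theorem spread_add (f g : C →ₗ[k] A) (c : C) :
    D.spread (f + g) c = D.spread f c + D.spread g c := by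
  simp only [spread, LinearMap.comp_apply, LinearMap.comp_add]
  generalize Coalgebra.comul (R := k) c = t
  induction t with
  | zero => simp
  | add s s' hs hs' => simp only [map_add, hs, hs']; abel
  | tmul c d => rfl

theorem spread_smul (r : k) (f : C →ₗ[k] A) (c : C) :
    D.spread (r • f) c = r • D.spread f c := by
  simp only [spread, LinearMap.comp_apply, LinearMap.comp_smul]
  generalize Coalgebra.comul (R := k) c = t
  induction t with
  | zero => simp
  | add s s' hs hs' => simp only [map_add, hs, hs', smul_add]
  | tmul c d => rfl

theorem spread_zero (c : C) : D.spread 0 c = 0 := by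
  simpa using D.spread_smul 0 0 c

theorem op_smul_smul_ind (r : k) (a : A) (x : D.Ind A) : op a • r • x = r • op a • x :=
  map_smul (rightAct k A (D.Ind A) a) r x

end Linear

/-- The condition
`∑ c₍₁₎ ⊗ γ(c₍₂₎)(d) = ∑ d₍₂₎ · γ(c)(d₍₁₎)₍₋₁₎ ⊗ γ(c)(d₍₁₎)₍₀₎` for all `c` and `d`, on a map
`γ : C → Hom(C, A)`. -/
def colinear : Submodule k (C →ₗ[k] C →ₗ[k] A) where
  carrier := {γ | ∀ c d : C,
    (γ.flip d).lTensor C (Coalgebra.comul (R := k) c) = D.spread (γ c) d}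
  add_mem' {γ γ'} h h' c d := by
    have : (γ + γ').flip d = γ.flip d + γ'.flip d := rfl
    rw [this, LinearMap.lTensor_add, LinearMap.add_apply, h, h', LinearMap.add_apply, spread_add]
  zero_mem' c d := by
    have : (0 : C →ₗ[k] C →ₗ[k] A).flip d = 0 := rfl
    rw [this, LinearMap.lTensor_zero, LinearMap.zero_apply, LinearMap.zero_apply, spread_zero]
  smul_mem' r γ h c d := by
    have : (r • γ).flip d = r • γ.flip d := rfl
    rw [this, LinearMap.lTensor_smul, LinearMap.smul_apply, h, LinearMap.smul_apply, spread_smul]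

/-- The `k`-module `V'₅` of `(A, A # C*)`-bimodule maps `C ⊗ A → Hom(C, A)`. -/
def V'₅ : Submodule k (D.Ind A →ₗ[k] D.Koppinen) where
  carrier := {ψ | (∀ (a : A) (x : D.Ind A), ψ (D.leftMul a x) = D.koppinenA a * ψ x) ∧
    ∀ (s : D.Smash) (x : D.Ind A),
      ψ (D.smashAct (D.indCoact A) s x) = ψ x * D.smashToKoppinen s}
  add_mem' h h' := ⟨fun a x => by simp [h.1, h'.1, mul_add],
    fun s x => by simp [h.2, h'.2, add_mul]⟩
  zero_mem' := ⟨fun a x => by simp, fun s x => by simp⟩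
  smul_mem' r _ h := ⟨fun a x => by simp [h.1], fun s x => by simp [h.2]⟩

/-- The `k`-module `V₁` of left `A`-linear morphisms of Doi-Hopf modules
`ν : C ⊗ C ⊗ A → C ⊗ A` such that
`ν(c ⊗ d ⊗ 1) = ∑ d₍₂₎ · x₍₋₁₎ ⊗ x₍₀₎` with `x = (ε ⊗ A) ν(c ⊗ d₍₁₎ ⊗ 1)`. -/
def V₁ : Submodule k (D.Ind (D.Ind A) →ₗ[k] D.Ind A) where
  carrier := {ν | (∀ (a : A) (x : D.Ind (D.Ind A)), ν (op a • x) = op a • ν x) ∧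
    (∀ x : D.Ind (D.Ind A), D.indCoact A (ν x) = ν.lTensor C (D.indCoact (D.Ind A) x)) ∧
    (∀ (c d : C) (b a : A),
      ν (D.tmul c (D.tmul d (b * a))) = D.leftMul b (ν (D.tmul c (D.tmul d a)))) ∧
    ∀ c d : C, D.spread (D.indCounit A ∘ₗ ν ∘ₗ D.mkInd (D.Ind A) c ∘ₗ D.inclC) d =
      ν (D.tmul c (D.tmul d 1))}
  add_mem' {ν ν'} h h' := ⟨fun a x => by simp [h.1, h'.1],
    fun x => by simp [h.2.1, h'.2.1, LinearMap.lTensor_add],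
    fun c d b a => by simp [h.2.2.1, h'.2.2.1],
    fun c d => by
      rw [LinearMap.add_comp, LinearMap.comp_add, spread_add, h.2.2.2, h'.2.2.2]; rfl⟩
  zero_mem' := ⟨fun a x => by simp, fun x => by simp, fun c d b a => by simp,
    fun c d => by rw [LinearMap.zero_comp, LinearMap.comp_zero, spread_zero]; rfl⟩
  smul_mem' r ν h := ⟨fun a x => by simp [h.1, op_smul_smul_ind],
    fun x => by simp [h.2.1, LinearMap.lTensor_smul],
    fun c d b a => by simp [h.2.2.1],
    fun c d => by
      rw [LinearMap.smul_comp, LinearMap.comp_smul, spread_smul, h.2.2.2]; rfl⟩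

/-- `ν` is normalized if `∑ ν(c₍₁₎ ⊗ c₍₂₎ ⊗ a) = c ⊗ a`. -/
def Normalized₁ (ν : D.Ind (D.Ind A) →ₗ[k] D.Ind A) : Prop :=
  ∀ (c : C) (a : A),
    ν ((D.indCoact A (D.tmul c a) : C ⊗[k] D.Ind A) : D.Ind (D.Ind A)) = D.tmul c a

/-- The `k`-module `V₂` of maps `λ : C ⊗ C → C ⊗ A` with
`∑ d₍₂₎ · x₍₋₁₎ ⊗ x₍₀₎ = λ(c ⊗ d)` where `x = (ε ⊗ A) λ(c ⊗ d₍₁₎)`,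
`∑ a₍₀₎ λ(c · a₍₋₂₎ ⊗ d · a₍₋₁₎) = λ(c ⊗ d) a` and
`∑ c₍₁₎ ⊗ λ(c₍₂₎ ⊗ d) = ρ(λ(c ⊗ d))`. -/
def V₂ : Submodule k (C ⊗[k] C →ₗ[k] D.Ind A) where
  carrier := {l | (∀ c d : C,
      D.spread (D.indCounit A ∘ₗ l ∘ₗ TensorProduct.mk k C C c) d = l (c ⊗ₜ d)) ∧
    (∀ (a : A) (c d : C), D.sum₂ D.leftMul l a c d = op a • l (c ⊗ₜ d)) ∧
    ∀ c d : C, (l ∘ₗ (TensorProduct.mk k C C).flip d).lTensor C (Coalgebra.comul (R := k) c) =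
      D.indCoact A (l (c ⊗ₜ d))}
  add_mem' {l l'} h h' := ⟨fun c d => by
      rw [LinearMap.add_comp, LinearMap.comp_add, spread_add, h.1, h'.1]; rfl,
    fun a c d => by
      rw [sum₂_add, h.2.1, h'.2.1, LinearMap.add_apply, smul_add],
    fun c d => by
      rw [LinearMap.add_comp, LinearMap.lTensor_add, LinearMap.add_apply, h.2.2, h'.2.2,
        LinearMap.add_apply, map_add]⟩
  zero_mem' := ⟨fun c d => by
      rw [LinearMap.zero_comp, LinearMap.comp_zero, spread_zero]; rfl,
    fun a c d => by rw [sum₂_zero, LinearMap.zero_apply, smul_zero],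
    fun c d => by
      rw [LinearMap.zero_comp, LinearMap.lTensor_zero, LinearMap.zero_apply,
        LinearMap.zero_apply, map_zero]⟩
  smul_mem' r l h := ⟨fun c d => by
      rw [LinearMap.smul_comp, LinearMap.comp_smul, spread_smul, h.1]; rfl,
    fun a c d => by
      rw [sum₂_smul, h.2.1, LinearMap.smul_apply, op_smul_smul_ind],
    fun c d => by
      rw [LinearMap.smul_comp, LinearMap.lTensor_smul, LinearMap.smul_apply, h.2.2,
        LinearMap.smul_apply, map_smul]⟩

/-- `λ` is normalized if `∑ λ(c₍₁₎ ⊗ c₍₂₎) = c ⊗ 1`. -/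
def Normalized₂ (l : C ⊗[k] C →ₗ[k] D.Ind A) : Prop :=
  ∀ c : C, l (Coalgebra.comul (R := k) c) = D.tmul c 1

/-- The `k`-module `V₃` of maps `θ : C ⊗ C → A` with
`θ(c ⊗ d) a = ∑ a₍₀₎ θ(c · a₍₋₂₎ ⊗ d · a₍₋₁₎)` and
`∑ c₍₁₎ ⊗ θ(c₍₂₎ ⊗ d) = ∑ d₍₂₎ · θ(c ⊗ d₍₁₎)₍₋₁₎ ⊗ θ(c ⊗ d₍₁₎)₍₀₎`. -/
def V₃ : Submodule k (C ⊗[k] C →ₗ[k] A) where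
  carrier := {θ | (∀ (a : A) (c d : C),
      θ (c ⊗ₜ d) * a = D.sum₂ (LinearMap.mul k A) θ a c d) ∧
    TensorProduct.curry θ ∈ D.colinear}
  add_mem' {θ θ'} h h' := ⟨fun a c d => by
      rw [sum₂_add, ← h.1, ← h'.1, LinearMap.add_apply, add_mul],
    by
      have : TensorProduct.curry (θ + θ') = TensorProduct.curry θ + TensorProduct.curry θ' := rfl
      rw [this]
      exact add_mem h.2 h'.2⟩
  zero_mem' := ⟨fun a c d => by rw [sum₂_zero, LinearMap.zero_apply, zero_mul],
    by
      have : TensorProduct.curry (0 : C ⊗[k] C →ₗ[k] A) = 0 := rfl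
      rw [this]
      exact zero_mem D.colinear⟩
  smul_mem' r θ h := ⟨fun a c d => by
      rw [sum₂_smul, ← h.1, LinearMap.smul_apply, smul_mul_assoc],
    by
      have : TensorProduct.curry (r • θ) = r • TensorProduct.curry θ := rfl
      rw [this]
      exact D.colinear.smul_mem r h.2⟩

/-- `θ` is normalized if `∑ θ(c₍₁₎ ⊗ c₍₂₎) = ε(c) 1`. -/
def Normalized₃ (_ : DoiHopfDatum k H A C) (θ : C ⊗[k] C →ₗ[k] A) : Prop :=
  ∀ c : C, θ (Coalgebra.comul (R := k) c) = algebraMap k A (Coalgebra.counit (R := k) c)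

/-- The left action of `A` on `Hom(C, A)`, restricted from the ring `#(C, A)`:
`(a · f)(c) = ∑ a₍₀₎ f(c · a₍₋₁₎)`. -/
def leftActK : A →ₗ[k] D.Koppinen →ₗ[k] D.Koppinen :=
  LinearMap.mul k D.Koppinen ∘ₗ D.koppinenA.toLinearMap

/-- The `k`-module `V₄` of maps `γ : C → Hom(C, A)` with
`∑ a₍₀₎ · γ(c · a₍₋₁₎) = γ(c) · a` and
`∑ c₍₁₎ ⊗ γ(c₍₂₎)(d) = ∑ d₍₂₎ · γ(c)(d₍₁₎)₍₋₁₎ ⊗ γ(c)(d₍₁₎)₍₀₎`. -/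
def V₄ : Submodule k (C →ₗ[k] D.Koppinen) where
  carrier := {γ | (∀ (a : A) (c : C), D.sum₁ D.leftActK γ a c = γ c * D.koppinenA a) ∧
    D.toHom.toLinearMap ∘ₗ γ ∈ D.colinear}
  add_mem' {γ γ'} h h' := ⟨fun a c => by
      rw [sum₁_add, h.1, h'.1, LinearMap.add_apply, add_mul],
    add_mem h.2 h'.2⟩
  zero_mem' := ⟨fun a c => by rw [sum₁_zero, LinearMap.zero_apply, zero_mul],
    zero_mem D.colinear⟩
  smul_mem' r γ h := ⟨fun a c => by
      rw [sum₁_smul, h.1, LinearMap.smul_apply, smul_mul_assoc],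
    D.colinear.smul_mem r h.2⟩

/-- `γ` is normalized if `∑ γ(c₍₁₎)(c₍₂₎) = ε(c) 1`. -/
def Normalized₄ (γ : C →ₗ[k] D.Koppinen) : Prop :=
  ∀ c : C, TensorProduct.lift (D.toHom.toLinearMap ∘ₗ γ) (Coalgebra.comul (R := k) c) =
    algebraMap k A (Coalgebra.counit (R := k) c)

/-- The `k`-module `V₅` of `A`-bimodule maps `ψ : C ⊗ A → Hom(C, A)` with
`∑ c₍₁₎ ⊗ ψ(c₍₂₎ ⊗ 1)(d) = ∑ d₍₂₎ · ψ(c ⊗ 1)(d₍₁₎)₍₋₁₎ ⊗ ψ(c ⊗ 1)(d₍₁₎)₍₀₎`. -/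
def V₅ : Submodule k (D.Ind A →ₗ[k] D.Koppinen) where
  carrier := {ψ | (∀ (a : A) (x : D.Ind A), ψ (D.leftMul a x) = D.koppinenA a * ψ x) ∧
    (∀ (a : A) (x : D.Ind A), ψ (op a • x) = ψ x * D.koppinenA a) ∧
    D.toHom.toLinearMap ∘ₗ ψ ∘ₗ D.inclC ∈ D.colinear}
  add_mem' h h' := ⟨fun a x => by simp [h.1, h'.1, mul_add],
    fun a x => by simp [h.2.1, h'.2.1, add_mul], by
      rw [LinearMap.add_comp, LinearMap.comp_add]
      exact add_mem h.2.2 h'.2.2⟩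
  zero_mem' := ⟨fun a x => by simp, fun a x => by simp, by
      rw [LinearMap.zero_comp, LinearMap.comp_zero]
      exact zero_mem D.colinear⟩
  smul_mem' r _ h := ⟨fun a x => by simp [h.1], fun a x => by simp [h.2.1],
    by
      rw [LinearMap.smul_comp, LinearMap.comp_smul]
      exact D.colinear.smul_mem r h.2.2⟩

/-- `ψ` is normalized if `∑ ψ(c₍₁₎ ⊗ 1)(c₍₂₎) = ε(c) 1`. -/
def Normalized₅ (ψ : D.Ind A →ₗ[k] D.Koppinen) : Prop := D.Normalized₄ (ψ ∘ₗ D.inclC)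

end DoiHopfDatum

end DoiHopf

end

noncomputable section

namespace DoiHopf

variable {k : Type u₁} {H : Type u₂} {A C : Type u} [CommRing k] [Ring H] [Bialgebra k H] [Ring A]
  [Algebra k A] [AddCommGroup C] [Module k C] [Coalgebra k C] [Module Hᵐᵒᵖ C]
  [IsScalarTower k Hᵐᵒᵖ C]

namespace DoiHopfDatum

/-! Natural transformations `P G ⟶ T` are handled by an Eilenberg-Watts argument. An element `n` of
a right `A`-module `N` is the image of `1` under the `A`-linear map `a ↦ n a`, so naturality forces
`φ_N(c ⊗ n) = n ⊗ φ_A(c ⊗ 1)`, once `A ⊗_A #(C, A)` is identified with `#(C, A)`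
(`appLin_indMap_orbit`). Naturality along left multiplications of `A` is left `A`-linearity of
`φ_A`. Conversely, left linearity of a bimodule map `ψ` makes `c ⊗ n ↦ n ⊗ ψ(c ⊗ 1)` agree with `n ⊗
ψ` along the maps `a ↦ n a`, and so linearity over `A # C*` passes from `C ⊗ A` to every `C ⊗ N`.

To compare `V'₅` with `V₅`, write `a # c* = (1 # c*)(a # ε)`: linearity over `A # C*` is right
`A`-linearity together with linearity for the elements `1 # c*`. At `c ⊗ 1`, evaluated at `d`, the
latter is the colinearity identity in `C ⊗ A` contracted with `c*` (`map_smashAct_one_iff`). Hence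
`V₅ ≤ V'₅`. Equality holds when functionals separate the elements of `C ⊗ A`, and this is the role
of projectivity: `C` embeds as a direct summand in a free module (`eq_of_forall_dual_rTensor`).

The modules `V_i` are compared by three devices. A left `A`-linear map on `C ⊗ A` or `C ⊗ C ⊗ A` is
determined by its restriction to the elements with last factor `1` (`V₅` and `V₄`, `V₁` and `V₂`).
Currying relates `V₃` and `V₄`. Finally `C ⊗ A` is a cofree comodule, so a colinear map `ν` into it
is determined by `(ε ⊗ A) ν` (`V₁` and `V₃`); the inverse sends `θ` to `c ⊗ d ⊗ a ↦ ∑ c₍₁₎ ⊗ a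
θ(c₍₂₎ ⊗ d)`. The resulting chain is `V'`, `V₅`, `V₄`, `V₃`, `V₁`, `V₂`.

For the splitting condition, `χ_M ∘ φ ∘ ρ_M` is the action on `M` of the single element `c ↦ ∑
ψ(c₍₁₎ ⊗ 1)(c₍₂₎)` of `#(C, A)` (`chiLin_bimodLin`). The normalization condition says that this
element is the unit. An element that acts as the identity on every Doi-Hopf module is the unit,
because its action on `c ⊗ 1` in `C ⊗ A`, followed by `ε ⊗ A`, returns its value at `c`
(`splitsUnit_iff`). -/

/-- Over a projective module, the linear forms separate the elements of the tensor products. -/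
theorem eq_of_forall_dual_rTensor {R V W : Type*} [CommRing R] [AddCommGroup V] [Module R V]
    [AddCommGroup W] [Module R W] (hV : Module.Projective R V) {x y : V ⊗[R] W}
    (h : ∀ f : V →ₗ[R] R,
      TensorProduct.lid R W (f.rTensor W x) = TensorProduct.lid R W (f.rTensor W y)) : x = y := by
  classical
  -- `s` splits the canonical surjection from the free module on the elements of `V`. Its
  -- coordinates are linear forms on `V`, so the hypothesis gives equality after `s ⊗ W`, and the
  -- splitting then removes `s`.
  obtain ⟨s, hs⟩ := Module.projective_def'.1 hV
  have key : s.rTensor W x = s.rTensor W y := by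
    apply (TensorProduct.finsuppScalarLeft R W V).injective
    ext i
    rw [TensorProduct.finsuppScalarLeft_apply, TensorProduct.finsuppScalarLeft_apply,
      ← LinearMap.rTensor_comp_apply, ← LinearMap.rTensor_comp_apply]
    exact h _
  have := congrArg ((Finsupp.linearCombination R id).rTensor W) key
  rwa [← LinearMap.rTensor_comp_apply, ← LinearMap.rTensor_comp_apply, hs, LinearMap.rTensor_id,
    LinearMap.id_apply, LinearMap.id_apply] at this

/-- A pair of linear maps that restrict to mutually inverse maps between two submodules. -/
def submoduleEquiv {R X Y : Type*} [CommRing R] [AddCommGroup X] [Module R X] [AddCommGroup Y]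
    [Module R Y] {p : Submodule R X} {q : Submodule R Y} (f : X →ₗ[R] Y) (g : Y →ₗ[R] X)
    (hf : ∀ x ∈ p, f x ∈ q) (hg : ∀ y ∈ q, g y ∈ p) (hgf : ∀ x ∈ p, g (f x) = x)
    (hfg : ∀ y ∈ q, f (g y) = y) : p ≃ₗ[R] q :=
  LinearEquiv.ofLinearMap (f.restrict hf) (g.restrict hg)
    (LinearMap.ext fun y => Subtype.ext (hfg y.1 y.2))
    (LinearMap.ext fun x => Subtype.ext (hgf x.1 x.2))

variable (D : DoiHopfDatum k H A C)

/-! ### The cofree comodules `C ⊗ M`. -/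

section Induced

variable {M X : Type*} [AddCommGroup M] [Module k M] [AddCommGroup X] [Module k X]

/-- Linear maps on `C ⊗ M` that agree on the elements `c ⊗ m` are equal. -/
theorem ind_ext {f g : D.Ind M →ₗ[k] X} (h : ∀ c m, f (D.tmul c m) = g (D.tmul c m)) : f = g :=
  TensorProduct.ext' (g := (f : C ⊗[k] M →ₗ[k] X)) (h := (g : C ⊗[k] M →ₗ[k] X)) h

variable (M) in
theorem indCounit_tmul (c : C) (m : M) :
    D.indCounit M (D.tmul c m) = Coalgebra.counit (R := k) c • m := by
  change TensorProduct.lid k M ((Coalgebra.counit (R := k) (A := C)).rTensor M (c ⊗ₜ[k] m)) = _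
  simp

theorem indCounit_indCoact (x : D.Ind M) : D.indCounit (D.Ind M) (D.indCoact M x) = x :=
  (isLeftCoaction_ind (C := C) M).counit x

theorem indCoact_coassoc (x : D.Ind M) :
    D.indCoact (D.Ind M) (D.indCoact M x) = (D.indCoact M).lTensor C (D.indCoact M x) :=
  (isLeftCoaction_ind (C := C) M).coassoc x

theorem indCoact_lTensor {N : Type*} [AddCommGroup N] [Module k N] (f : M →ₗ[k] N)
    (x : D.Ind M) : D.indCoact N (f.lTensor C x) =
      (f.lTensor C).lTensor C (D.indCoact M x) := indCoact_map f x

theorem indCoact_tmul (c : C) (m : M) : D.indCoact M (D.tmul c m) =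
    ((D.mkInd M).flip m).lTensor C (Coalgebra.comul (R := k) c) := by
  change TensorProduct.assoc k C C M (Coalgebra.comul (R := k) c ⊗ₜ[k] m) = _
  generalize Coalgebra.comul (R := k) c = v
  induction v with
  | zero => simp only [zero_tmul, map_zero]; rfl
  | add s s' hs hs' => rw [map_add, add_tmul, map_add, hs, hs']; rfl
  | tmul x y => rfl

/-- This is the counit law of the coalgebra `C` on its second leg, whereas the comodule axiom gives
the law on the first. It is what allows a colinear map into `C ⊗ M` to be rebuilt from its composite
with `ε ⊗ M`. -/
theorem indCounit_lTensor_indCoact (x : D.Ind M) :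
    (D.indCounit M).lTensor C (D.indCoact M x) = x := by
  have key : ((D.indCounit M).lTensor C : C ⊗[k] D.Ind M →ₗ[k] D.Ind M) ∘ₗ D.indCoact M =
      LinearMap.id := D.ind_ext fun c m => by
    rw [LinearMap.comp_apply, indCoact_tmul, ← LinearMap.lTensor_comp_apply]
    have h2 := congrArg (fun z => (TensorProduct.rid k C z) ⊗ₜ[k] m)
      (Coalgebra.lTensor_counit_comul (R := k) c)
    simp only [TensorProduct.rid_tmul, one_smul] at h2
    refine Eq.trans ?_ h2
    generalize Coalgebra.comul (R := k) c = v
    induction v with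
    | zero => simp only [map_zero, zero_tmul]
    | add s s' hs hs' => simp only [map_add, add_tmul, hs, hs']
    | tmul x y =>
      rw [LinearMap.lTensor_tmul, LinearMap.lTensor_tmul, TensorProduct.rid_tmul, smul_tmul]
      exact congrArg (x ⊗ₜ[k] ·) (D.indCounit_tmul M y m)
  exact LinearMap.congr_fun key x

end Induced

/-! ### The two-sided structure of `C ⊗ A`. -/

/-- `ε ⊗ A` is contraction against `kone`, and `kone` is a right unit for `kmul`. -/
theorem indCounit_spread (f : C →ₗ[k] A) (c : C) : D.indCounit A (D.spread f c) = f c := by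
  have h4 := (D.contract_eq D.kone (D.spread f c)).trans (congrArg (D.indCounit A)
    (tri_kone (D.isDoiHopfCoaction_indCoact A) (D.spread f c : D.Ind A)))
  rw [← h4]
  exact LinearMap.congr_fun (D.kmul_kone f) c

theorem leftMul_mul (a b : A) (x : D.Ind A) : D.leftMul (a * b) x = D.leftMul a (D.leftMul b x) :=
  LinearMap.congr_fun (D.ind_ext (f := D.leftMul (a * b)) (g := D.leftMul a ∘ₗ D.leftMul b)
    fun c m => by simp only [LinearMap.comp_apply, leftMul_tmul, mul_assoc]) x

theorem leftMul_one (x : D.Ind A) : D.leftMul 1 x = x :=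
  LinearMap.congr_fun (D.ind_ext (f := D.leftMul 1) (g := LinearMap.id)
    fun c m => by simp only [LinearMap.id_apply, leftMul_tmul, one_mul]) x

/-- Left multiplication by `b` on `A` is right `A`-linear, and tensoring a right linear map with `C`
gives a right linear map. -/
theorem leftMul_op_smul (a b : A) (x : D.Ind A) :
    D.leftMul b (op a • x) = op a • D.leftMul b x :=
  lTensor_diagAct (LinearMap.mul k A b) (fun a m => by simp [mul_assoc]) (D.coactA a) x

theorem indCounit_leftMul (a : A) (x : D.Ind A) :
    D.indCounit A (D.leftMul a x) = a * D.indCounit A x :=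
  LinearMap.congr_fun (D.ind_ext (f := D.indCounit A ∘ₗ D.leftMul a)
    (g := LinearMap.mul k A a ∘ₗ D.indCounit A) fun c m => by
      simp only [LinearMap.comp_apply, leftMul_tmul, indCounit_tmul, LinearMap.mul_apply',
        mul_smul_comm]) x

theorem indCoact_leftMul (a : A) (x : D.Ind A) :
    D.indCoact A (D.leftMul a x) = (D.leftMul a).lTensor C (D.indCoact A x) :=
  D.indCoact_lTensor (LinearMap.mul k A a) x

theorem tmul_eq_leftMul (c : C) (a : A) : D.tmul c a = D.leftMul a (D.inclC c) := by
  rw [inclC_apply, leftMul_tmul, mul_one]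

/-- With `twist₂_eq`, this turns the Sweedler sums in `V₂`, `V₃` and `V₄` into values of linear maps
at the right translates `(c ⊗ 1) a` and `(c ⊗ d ⊗ 1) a`. -/
theorem twist_eq (a : A) (c : C) : D.twist a c = op a • D.inclC c := (D.act_tmul_one a c).symm

/-- Left multiplication is colinear and right `A`-linear, and `tri` is built from the coaction and
the right action alone. -/
theorem tri_leftMul (f : C →ₗ[k] A) (b : A) (x : D.Ind A) :
    D.tri (D.indCoact A) f (D.leftMul b x) = D.leftMul b (D.tri (D.indCoact A) f x) := by
  simp only [tri, LinearMap.comp_apply, indCoact_leftMul]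
  generalize D.indCoact A x = t
  induction t with
  | zero => simp only [map_zero]
  | add s s' hs hs' => simp only [map_add, hs, hs']
  | tmul c z => exact (D.leftMul_op_smul (f c) b z).symm

/-- The right action on `C ⊗ (C ⊗ A)` is diagonal: the outer coaction of `a` acts on `c`, and `a₍₀₎`
acts on `d ⊗ 1` through a second coaction. -/
theorem twist₂_eq (a : A) (c d : C) :
    D.twist₂ a c d = (op a • D.tmul c (D.inclC d) : D.Ind (D.Ind A)) := by
  change _ = diagAct k H A C (D.Ind A) (D.coactA a) (c ⊗ₜ[k] D.inclC d)
  rw [twist₂]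
  generalize D.coactA a = t
  induction t with
  | zero => simp only [map_zero, LinearMap.zero_apply]; rfl
  | add s s' hs hs' => simp only [map_add, LinearMap.add_apply, hs, hs']; rfl
  | tmul h x => exact congrArg ((op h • c) ⊗ₜ[k] ·) (D.twist_eq x d)

/-! ### Extension of linear maps on `C` and `C ⊗ C` to left `A`-linear maps -/

section Extension

variable {X : Type*} [AddCommGroup X] [Module k X] (L : A →ₗ[k] X →ₗ[k] X)

/-- The map `c ⊗ a ↦ L(a, γ(c))` as a function of `γ : C → X`. -/
def ext₁ : (C →ₗ[k] X) →ₗ[k] D.Ind A →ₗ[k] X :=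
  (LinearMap.lcomp k X (TensorProduct.comm k C A).toLinearMap ∘ₗ
    TensorProduct.uncurry (.id k) A C X ∘ₗ
    (LinearMap.mk₂ k (fun (γ : C →ₗ[k] X) (a : A) => L a ∘ₗ γ)
      (fun γ γ' a => LinearMap.comp_add _ _ _) (fun r γ a => LinearMap.comp_smul _ _ _)
      (fun γ a b => by rw [map_add, LinearMap.add_comp])
      (fun r γ a => by rw [map_smul, LinearMap.smul_comp])) :
    (C →ₗ[k] X) →ₗ[k] C ⊗[k] A →ₗ[k] X)

theorem ext₁_tmul (γ : C →ₗ[k] X) (c : C) (a : A) : D.ext₁ L γ (D.tmul c a) = L a (γ c) := rfl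

/-- The map `c ⊗ d ⊗ a ↦ L(a, Θ(c ⊗ d))` as a function of `Θ : C ⊗ C → X`. -/
def ext₂ : (C ⊗[k] C →ₗ[k] X) →ₗ[k] D.Ind (D.Ind A) →ₗ[k] X :=
  (LinearMap.lcomp k X ((TensorProduct.comm k (C ⊗[k] C) A).toLinearMap ∘ₗ
      (TensorProduct.assoc k C C A).symm.toLinearMap) ∘ₗ
    TensorProduct.uncurry (.id k) A (C ⊗[k] C) X ∘ₗ
    (LinearMap.mk₂ k (fun (γ : C ⊗[k] C →ₗ[k] X) (a : A) => L a ∘ₗ γ)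
      (fun γ γ' a => LinearMap.comp_add _ _ _) (fun r γ a => LinearMap.comp_smul _ _ _)
      (fun γ a b => by rw [map_add, LinearMap.add_comp])
      (fun r γ a => by rw [map_smul, LinearMap.smul_comp])) :
    (C ⊗[k] C →ₗ[k] X) →ₗ[k] C ⊗[k] (C ⊗[k] A) →ₗ[k] X)

theorem ext₂_tmul (Θ : C ⊗[k] C →ₗ[k] X) (c d : C) (a : A) :
    D.ext₂ L Θ (D.tmul c (D.tmul d a)) = L a (Θ (c ⊗ₜ d)) := rfl

variable {L}

/-- Linear maps on `C ⊗ C ⊗ A` that agree on the elements `c ⊗ d ⊗ a` are equal. -/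
theorem ind_ind_ext {f g : D.Ind (D.Ind A) →ₗ[k] X}
    (h : ∀ c d a, f (D.tmul c (D.tmul d a)) = g (D.tmul c (D.tmul d a))) : f = g :=
  D.ind_ext fun c x => LinearMap.congr_fun
    (D.ind_ext (f := f ∘ₗ D.mkInd (D.Ind A) c) (g := g ∘ₗ D.mkInd (D.Ind A) c) (h c)) x

/-- In this form the condition `∑ a₍₀₎ γ(c · a₍₋₁₎) = γ(c) a` says that the left linear extension of
`γ` respects right multiplication at the element `c ⊗ 1`. `sum₂_eq` plays the same role on `C ⊗ C ⊗
A`. -/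
theorem sum₁_eq (γ : C →ₗ[k] X) (a : A) (c : C) :
    D.sum₁ L γ a c = D.ext₁ L γ (op a • D.inclC c) := by
  have key : TensorProduct.lift L.flip ∘ₗ γ.rTensor A = (D.ext₁ L γ : C ⊗[k] A →ₗ[k] X) :=
    TensorProduct.ext' fun c a => rfl
  rw [← twist_eq]
  exact LinearMap.congr_fun key _

theorem sum₂_eq (Θ : C ⊗[k] C →ₗ[k] X) (a : A) (c d : C) :
    D.sum₂ L Θ a c d = D.ext₂ L Θ (op a • D.tmul c (D.inclC d)) := by
  have key : TensorProduct.lift L.flip ∘ₗ Θ.rTensor A ∘ₗ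
      (TensorProduct.assoc k C C A).symm.toLinearMap = D.ext₂ L Θ :=
    D.ind_ind_ext fun c d a => rfl
  rw [← twist₂_eq]
  exact LinearMap.congr_fun key _

/-- Left multiplication by `b` on the last factor commutes with the right action, and `c ⊗ d ⊗ b` is
its value at `c ⊗ d ⊗ 1`. -/
theorem leftMul_lTensor_op_smul (a b : A) (c d : C) :
    (op a • D.tmul c (D.tmul d b) : D.Ind (D.Ind A)) =
      (D.leftMul b).lTensor C (op a • D.tmul c (D.inclC d) : D.Ind (D.Ind A)) := by
  refine Eq.trans ?_ (lTensor_diagAct (D.leftMul b) (fun a m => D.leftMul_op_smul a b m)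
    (D.coactA a) (c ⊗ₜ D.inclC d)).symm
  rw [LinearMap.lTensor_tmul, ← tmul_eq_leftMul]
  rfl

theorem ext₂_lTensor_leftMul (hL : ∀ a b x, L (a * b) x = L a (L b x)) (Θ : C ⊗[k] C →ₗ[k] X)
    (b : A) (x : D.Ind (D.Ind A)) :
    D.ext₂ L Θ ((D.leftMul b).lTensor C x : C ⊗[k] D.Ind A) = L b (D.ext₂ L Θ x) :=
  LinearMap.congr_fun (D.ind_ind_ext (f := D.ext₂ L Θ ∘ₗ ((D.leftMul b).lTensor C :
    C ⊗[k] D.Ind A →ₗ[k] C ⊗[k] D.Ind A)) (g := L b ∘ₗ D.ext₂ L Θ) fun _ _ a => hL b a _) x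

theorem ext₁_leftMul (hL : ∀ a b x, L (a * b) x = L a (L b x)) (γ : C →ₗ[k] X)
    (b : A) (x : D.Ind A) : D.ext₁ L γ (D.leftMul b x) = L b (D.ext₁ L γ x) :=
  LinearMap.congr_fun (D.ind_ext (f := D.ext₁ L γ ∘ₗ D.leftMul b) (g := L b ∘ₗ D.ext₁ L γ)
    fun _ a => hL b a _) x

/-- The left `A`-linear extension of `Θ : C ⊗ C → X` is right `A`-linear if
`∑ a₍₀₎ Θ(c · a₍₋₂₎ ⊗ d · a₍₋₁₎) = Θ(c ⊗ d) a`. -/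
theorem ext₂_op_smul [Module Aᵐᵒᵖ X] [IsScalarTower k Aᵐᵒᵖ X]
    (hL : ∀ a b x, L (a * b) x = L a (L b x)) (hLr : ∀ (a b : A) x, L b (op a • x) = op a • L b x)
    {Θ : C ⊗[k] C →ₗ[k] X} (h : ∀ a c d, D.sum₂ L Θ a c d = op a • Θ (c ⊗ₜ d)) (a : A)
    (x : D.Ind (D.Ind A)) : D.ext₂ L Θ (op a • x) = op a • D.ext₂ L Θ x :=
  LinearMap.congr_fun (D.ind_ind_ext (f := D.ext₂ L Θ ∘ₗ rightAct k A (D.Ind (D.Ind A)) a)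
    (g := rightAct k A X a ∘ₗ D.ext₂ L Θ) fun c d b => by
      simp only [LinearMap.comp_apply, rightAct_apply]
      -- Pulling `b` out on the left leaves the case `b = 1`, which is the hypothesis; `hLr` then
      -- moves `b` past `a` in `X`.
      rw [leftMul_lTensor_op_smul, ext₂_lTensor_leftMul D hL, ← sum₂_eq, h, hLr]
      rfl) x

end Extension

/-! ### `V₄` and `V₅` -/

theorem leftActK_mul (a b : A) (f : D.Koppinen) :
    D.leftActK (a * b) f = D.leftActK a (D.leftActK b f) := by
  change D.koppinenA (a * b) * f = D.koppinenA a * (D.koppinenA b * f)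
  rw [map_mul, mul_assoc]

theorem koppinenA_mul (a : A) (f : D.Koppinen) : D.koppinenA a * f = D.leftActK a f := rfl

theorem leftActK_one (f : D.Koppinen) : D.leftActK 1 f = f := by
  rw [← koppinenA_mul, map_one, one_mul]

/-- Since `c ⊗ a = a (c ⊗ 1)`, a left `A`-linear map is determined by its restriction along `inclC`.
-/
theorem ext₁_comp_inclC {ψ : D.Ind A →ₗ[k] D.Koppinen}
    (h : ∀ (a : A) (x : D.Ind A), ψ (D.leftMul a x) = D.koppinenA a * ψ x) :
    D.ext₁ D.leftActK (ψ ∘ₗ D.inclC) = ψ :=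
  D.ind_ext fun c a => by rw [ext₁_tmul, tmul_eq_leftMul, h]; rfl

theorem ext₁_leftActK_comp_inclC (γ : C →ₗ[k] D.Koppinen) :
    D.ext₁ D.leftActK γ ∘ₗ D.inclC = γ :=
  LinearMap.ext fun c => (D.ext₁_tmul _ γ c 1).trans (D.leftActK_one _)

/-- The isomorphism `V₅ ≅ V₄`, `ψ ↦ ψ(- ⊗ 1)`. -/
def equivV₅V₄ : D.V₅ ≃ₗ[k] D.V₄ :=
  submoduleEquiv (LinearMap.lcomp k D.Koppinen D.inclC) (D.ext₁ D.leftActK)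
    (fun ψ h => ⟨fun a c => by
      rw [sum₁_eq]
      refine (LinearMap.congr_fun (D.ext₁_comp_inclC h.1) _).trans ?_
      exact h.2.1 a _, h.2.2⟩)
    (fun γ h => ⟨D.ext₁_leftMul D.leftActK_mul γ, fun a => by
      refine LinearMap.congr_fun (D.ind_ext
        (f := D.ext₁ D.leftActK γ ∘ₗ rightAct k A (D.Ind A) a)
        (g := LinearMap.mulRight k (D.koppinenA a) ∘ₗ D.ext₁ D.leftActK γ) fun c b => ?_)
      simp only [LinearMap.comp_apply, rightAct_apply, LinearMap.mulRight_apply]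
      -- The factor `b` of `c ⊗ b = b (c ⊗ 1)` comes out on the left of both sides, because the left
      -- and right actions commute. What remains is the first condition of `V₄`.
      rw [tmul_eq_leftMul, ← leftMul_op_smul, ext₁_leftMul D D.leftActK_mul, ← sum₁_eq, h.1,
        ext₁_leftMul D D.leftActK_mul, ← koppinenA_mul, ← koppinenA_mul, mul_assoc]
      exact congrArg (fun z => _ * (z * _))
        (LinearMap.congr_fun (D.ext₁_leftActK_comp_inclC γ) c).symm, by
      rw [ext₁_leftActK_comp_inclC]; exact h.2⟩)
    (fun ψ h => D.ext₁_comp_inclC h.1)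
    (fun γ _ => D.ext₁_leftActK_comp_inclC γ)

theorem normalized₄_equivV₅V₄ (ψ : D.V₅) :
    D.Normalized₄ (D.equivV₅V₄ ψ).1 ↔ D.Normalized₅ ψ.1 := Iff.rfl

/-! ### `V₃` and `V₄` -/

/-- The left action on `Hom(C, A)` hides a coaction, `(x · f)(d) = ∑ x₍₀₎ f(d · x₍₋₁₎)`. Evaluation
at `d` with `x = a₍₀₎` exposes it and turns the single sum over `a` into the double one. -/
theorem sum₁_leftActK_apply (θ : C ⊗[k] C →ₗ[k] A) (a : A) (c d : C) :
    D.sum₁ D.leftActK (D.toHom.symm.toLinearMap ∘ₗ TensorProduct.curry θ) a c d =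
      D.sum₂ (LinearMap.mul k A) θ a c d := by
  rw [sum₁, sum₂, twist, LinearMap.mk₂_apply, twist₂]
  generalize D.coactA a = t
  induction t with
  | zero => simp only [map_zero]; rfl
  | add s s' hs hs' => simp only [map_add, ← hs, ← hs']; rfl
  | tmul h x =>
    refine (D.koppinenA_mul_apply x _ d).trans ?_
    rw [twist, LinearMap.mk₂_apply, LinearMap.lTensor_tmul, TensorProduct.map_tmul]
    simp only [AlgHom.toLinearMap_apply]
    generalize D.coactA x = u
    induction u with
    | zero => simp only [map_zero, tmul_zero]
    | add s s' hs hs' => simp only [map_add, tmul_add, hs, hs']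
    | tmul h' y => rfl

/-- The isomorphism `V₃ ≅ V₄`, `θ ↦ (c ↦ θ(c ⊗ -))`. -/
def equivV₃V₄ : D.V₃ ≃ₗ[k] D.V₄ :=
  submoduleEquiv
    ((TensorProduct.lift.equiv (.id k) C C A).symm.toLinearMap :
      (C ⊗[k] C →ₗ[k] A) →ₗ[k] (C →ₗ[k] D.Koppinen))
    (TensorProduct.uncurry (.id k) C C A : (C →ₗ[k] D.Koppinen) →ₗ[k] (C ⊗[k] C →ₗ[k] A))
    (fun θ h => ⟨fun a c => DFunLike.ext _ _ fun d => by
      -- Right multiplication by `koppinenA a` is pointwise right multiplication by `a`, so the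
      -- first conditions of `V₃` and `V₄` agree at each `d`.
      refine (D.sum₁_leftActK_apply θ a c d).trans ((h.1 a c d).symm.trans ?_)
      exact (D.mul_koppinenA_apply a (D.toHom.symm (TensorProduct.curry θ c)) d).symm, h.2⟩)
    (fun γ h => by
      have hγ : TensorProduct.curry (TensorProduct.uncurry (.id k) C C A
          (D.toHom.toLinearMap ∘ₗ γ)) = D.toHom.toLinearMap ∘ₗ γ :=
        LinearMap.ext fun c => LinearMap.ext fun d => rfl
      refine ⟨fun a c d => ?_, ?_⟩
      · refine (D.mul_koppinenA_apply a (γ c) d).symm.trans ?_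
        rw [← h.1]
        exact D.sum₁_leftActK_apply (TensorProduct.uncurry (.id k) C C A
          (D.toHom.toLinearMap ∘ₗ γ)) a c d
      · exact (congrArg (· ∈ D.colinear) hγ).mpr h.2)
    (fun θ _ => TensorProduct.ext' fun c d => rfl)
    (fun γ _ => LinearMap.ext fun c => DFunLike.ext _ _ fun d => rfl)

theorem normalized₄_equivV₃V₄ (θ : D.V₃) :
    D.Normalized₄ (D.equivV₃V₄ θ).1 ↔ D.Normalized₃ θ.1 := by
  have h : TensorProduct.lift (D.toHom.toLinearMap ∘ₗ (D.equivV₃V₄ θ).1) = θ.1 :=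
    TensorProduct.ext' fun c d => rfl
  rw [Normalized₄, h, Normalized₃]

/-! ### `V₁`, `V₂` and `V₃` -/

/-- The map `c ⊗ d ↦ c ⊗ d ⊗ 1`. -/
def inclCC : C ⊗[k] C →ₗ[k] D.Ind (D.Ind A) :=
  (D.inclC.lTensor C : C ⊗[k] C →ₗ[k] C ⊗[k] D.Ind A)

theorem inclCC_tmul (c d : C) : D.inclCC (c ⊗ₜ d) = D.tmul c (D.inclC d) := rfl

theorem inclCC_comul (c : C) :
    D.inclCC (Coalgebra.comul (R := k) c) = D.indCoact A (D.inclC c) := by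
  rw [inclC_apply, indCoact_tmul]; rfl

theorem indCoact_inclCC (c d : C) : D.indCoact (D.Ind A) (D.inclCC (c ⊗ₜ d)) =
    (D.inclCC ∘ₗ (TensorProduct.mk k C C).flip d).lTensor C (Coalgebra.comul (R := k) c) := by
  rw [inclCC_tmul, indCoact_tmul]; rfl

theorem ext₂_comp_inclCC {X : Type*} [AddCommGroup X] [Module k X] (L : A →ₗ[k] X →ₗ[k] X)
    (hL : ∀ x, L 1 x = x) (Θ : C ⊗[k] C →ₗ[k] X) : D.ext₂ L Θ ∘ₗ D.inclCC = Θ :=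
  TensorProduct.ext' fun _ _ => hL _

section V₁

variable {D} {ν : D.Ind (D.Ind A) →ₗ[k] D.Ind A} (h : ν ∈ D.V₁)
include h

theorem map_tmul_tmul_of_mem_V₁ (c d : C) (a : A) :
    ν (D.tmul c (D.tmul d a)) = D.leftMul a (ν (D.inclCC (c ⊗ₜ d))) := by
  rw [inclCC_tmul, inclC_apply, ← h.2.2.1, mul_one]

theorem ext₂_leftMul_of_mem_V₁ : D.ext₂ D.leftMul (ν ∘ₗ D.inclCC) = ν :=
  D.ind_ind_ext fun c d a => (map_tmul_tmul_of_mem_V₁ h c d a).symm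

theorem ext₂_mul_of_mem_V₁ : D.ext₂ (LinearMap.mul k A) (D.indCounit A ∘ₗ ν ∘ₗ D.inclCC) =
    D.indCounit A ∘ₗ ν :=
  D.ind_ind_ext fun c d a => by
    rw [LinearMap.comp_apply, map_tmul_tmul_of_mem_V₁ h, indCounit_leftMul]; rfl

/-- This is colinearity of `ν` at `c ⊗ d ⊗ 1`, where the coaction comultiplies `c` only. -/
theorem colinear_inclCC_of_mem_V₁ (c d : C) :
    (ν ∘ₗ D.inclCC ∘ₗ (TensorProduct.mk k C C).flip d).lTensor C (Coalgebra.comul (R := k) c) =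
      D.indCoact A (ν (D.inclCC (c ⊗ₜ d))) := by
  rw [h.2.1, indCoact_inclCC, ← LinearMap.lTensor_comp_apply]

theorem comp_inclCC_mem_V₂ : ν ∘ₗ D.inclCC ∈ D.V₂ :=
  ⟨h.2.2.2, fun a c d => by
    rw [sum₂_eq, ext₂_leftMul_of_mem_V₁ h, h.1]; rfl,
  colinear_inclCC_of_mem_V₁ h⟩

/-- The first condition holds because `ε ⊗ A` and `ν` are right `A`-linear. For the second,
colinearity of `ν` and the counit law identify `∑ c₍₁₎ ⊗ θ(c₍₂₎ ⊗ d)` with `ν(c ⊗ d ⊗ 1)`, and the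
last condition of `V₁` rewrites that element as the sum over `d`. -/
theorem comp_inclCC_mem_V₃ : D.indCounit A ∘ₗ ν ∘ₗ D.inclCC ∈ D.V₃ :=
  ⟨fun a c d => by
    rw [sum₂_eq, ext₂_mul_of_mem_V₁ h]
    exact (D.indCounit_smul a _).symm.trans (congrArg (D.indCounit A) (h.1 a _)).symm,
  fun c d => by
    refine Eq.trans ?_ (h.2.2.2 c d).symm
    refine (LinearMap.lTensor_comp_apply C (D.indCounit A)
      (ν ∘ₗ D.inclCC ∘ₗ (TensorProduct.mk k C C).flip d) _).trans ?_
    rw [colinear_inclCC_of_mem_V₁ h]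
    exact D.indCounit_lTensor_indCoact _⟩

end V₁

/-- The conditions of `V₂` are the conditions of `V₁` at the elements `c ⊗ d ⊗ 1`. They spread to
all of `C ⊗ C ⊗ A` because left multiplication commutes with the right action and with the coaction.
-/
theorem ext₂_leftMul_mem_V₁ {l : C ⊗[k] C →ₗ[k] D.Ind A} (h : l ∈ D.V₂) :
    D.ext₂ D.leftMul l ∈ D.V₁ :=
  ⟨D.ext₂_op_smul D.leftMul_mul D.leftMul_op_smul h.2.1,
  fun x => LinearMap.congr_fun (D.ind_ind_ext (f := D.indCoact A ∘ₗ D.ext₂ D.leftMul l)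
    (g := (D.ext₂ D.leftMul l).lTensor C ∘ₗ D.indCoact (D.Ind A)) fun c d b => by
      rw [LinearMap.comp_apply, LinearMap.comp_apply, ext₂_tmul, indCoact_leftMul, ← h.2.2,
        indCoact_tmul, ← LinearMap.lTensor_comp_apply, ← LinearMap.lTensor_comp_apply]
      rfl) x,
  fun c d b a => D.leftMul_mul b a _,
  fun c d => by
    have key : D.indCounit A ∘ₗ D.ext₂ D.leftMul l ∘ₗ D.mkInd (D.Ind A) c ∘ₗ D.inclC =
        D.indCounit A ∘ₗ l ∘ₗ TensorProduct.mk k C C c :=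
      LinearMap.ext fun d => congrArg (D.indCounit A) (D.leftMul_one _)
    rw [key, h.1, ext₂_tmul, leftMul_one]⟩

/-- The isomorphism `V₁ ≅ V₂`, `ν ↦ ν(- ⊗ - ⊗ 1)`. -/
def equivV₁V₂ : D.V₁ ≃ₗ[k] D.V₂ :=
  submoduleEquiv (LinearMap.lcomp k (D.Ind A) D.inclCC) (D.ext₂ D.leftMul)
    (fun _ h => comp_inclCC_mem_V₂ h) (fun _ h => D.ext₂_leftMul_mem_V₁ h)
    (fun _ h => ext₂_leftMul_of_mem_V₁ h)
    (fun l _ => D.ext₂_comp_inclCC D.leftMul D.leftMul_one l)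

theorem normalized₂_equivV₁V₂ (ν : D.V₁) :
    D.Normalized₂ (D.equivV₁V₂ ν).1 ↔ D.Normalized₁ ν.1 := by
  have key : ∀ c, (D.equivV₁V₂ ν).1 (Coalgebra.comul (R := k) c) =
      ν.1 (D.indCoact A (D.tmul c 1) : C ⊗[k] D.Ind A) :=
    fun c => congrArg ν.1 (D.inclCC_comul c)
  refine ⟨fun h c a => ?_, fun h c => (key c).trans (h c 1)⟩
  have hν := ext₂_leftMul_of_mem_V₁ ν.2
  -- Both sides of the normalization are left `A`-linear in `a`, so the case `a = 1` suffices.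
  rw [tmul_eq_leftMul, indCoact_leftMul, ← hν]
  refine (D.ext₂_lTensor_leftMul D.leftMul_mul _ a _).trans ?_
  rw [hν]
  exact congrArg (D.leftMul a) ((key c).symm.trans (h c))

/-- The map `c ⊗ d ⊗ a ↦ ∑ c₍₁₎ ⊗ a θ(c₍₂₎ ⊗ d)` as a function of `θ`. -/
def colinearExt : (C ⊗[k] C →ₗ[k] A) →ₗ[k] D.Ind (D.Ind A) →ₗ[k] D.Ind A :=
  LinearMap.lcomp k (D.Ind A) (D.indCoact (D.Ind A)) ∘ₗ
    (LinearMap.lTensorHom C : _ →ₗ[k] C ⊗[k] D.Ind (D.Ind A) →ₗ[k] C ⊗[k] A) ∘ₗ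
      D.ext₂ (LinearMap.mul k A)

theorem colinearExt_apply (θ : C ⊗[k] C →ₗ[k] A) (x : D.Ind (D.Ind A)) : D.colinearExt θ x =
    (D.ext₂ (LinearMap.mul k A) θ).lTensor C (D.indCoact (D.Ind A) x) := rfl

theorem indCounit_lTensor {M N : Type*} [AddCommGroup M] [Module k M] [AddCommGroup N]
    [Module k N] (f : M →ₗ[k] N) (x : D.Ind M) :
    D.indCounit N (f.lTensor C x) = f (D.indCounit M x) :=
  LinearMap.congr_fun (D.ind_ext (f := D.indCounit N ∘ₗ (f.lTensor C : D.Ind M →ₗ[k] D.Ind N))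
    (g := f ∘ₗ D.indCounit M) fun c m => by
      refine (D.indCounit_tmul N c (f m)).trans ?_
      rw [LinearMap.comp_apply, indCounit_tmul, map_smul]) x

/-- `ε` cancels the leg `c₍₁₎` that the coaction splits off, and the left linear extension of `θ` is
left. -/
theorem indCounit_colinearExt (θ : C ⊗[k] C →ₗ[k] A) :
    D.indCounit A ∘ₗ D.colinearExt θ = D.ext₂ (LinearMap.mul k A) θ :=
  LinearMap.ext fun x => (D.indCounit_lTensor _ _).trans
    (congrArg _ (D.indCounit_indCoact x))

theorem colinearExt_inclCC (θ : C ⊗[k] C →ₗ[k] A) (c d : C) :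
    D.colinearExt θ (D.inclCC (c ⊗ₜ d)) =
      ((TensorProduct.curry θ).flip d).lTensor C (Coalgebra.comul (R := k) c) := by
  rw [colinearExt_apply, indCoact_inclCC, ← LinearMap.lTensor_comp_apply, ← LinearMap.comp_assoc,
    ext₂_comp_inclCC D _ one_mul]
  rfl

/-- The extension is the coaction of `C ⊗ C ⊗ A` followed by `C ⊗ ext₂ θ`. It is right `A`-linear
since both maps are, by the first condition of `V₃`, and it is colinear by coassociativity. Its
value at `c ⊗ d ⊗ 1` is `∑ c₍₁₎ ⊗ θ(c₍₂₎ ⊗ d)`, so the last condition of `V₁` is the second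
condition of `V₃`. -/
theorem colinearExt_mem_V₁ {θ : C ⊗[k] C →ₗ[k] A} (h : θ ∈ D.V₃) : D.colinearExt θ ∈ D.V₁ :=
  ⟨fun a x => by
    have hr := D.ext₂_op_smul (L := LinearMap.mul k A) mul_assoc
      (fun a b x => (mul_assoc b x a).symm) (fun a c d => (h.1 a c d).symm)
    rw [colinearExt_apply, (D.isDoiHopfCoaction_indCoact (D.Ind A)).compat]
    exact lTensor_diagAct _ hr (D.coactA a) _,
  fun x => by
    refine (D.indCoact_lTensor (D.ext₂ (LinearMap.mul k A) θ)
      (D.indCoact (D.Ind A) x)).trans ?_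
    rw [indCoact_coassoc, ← LinearMap.lTensor_comp_apply]
    rfl,
  fun c d b a => by
    rw [colinearExt_apply, colinearExt_apply, indCoact_tmul, indCoact_tmul,
      ← LinearMap.lTensor_comp_apply, ← LinearMap.lTensor_comp_apply]
    refine Eq.trans ?_ (LinearMap.lTensor_comp_apply C (LinearMap.mul k A b) _ _)
    congr 2
    exact LinearMap.ext fun c => mul_assoc b a _,
  fun c d => by
    rw [← LinearMap.comp_assoc, indCounit_colinearExt]
    have key : D.ext₂ (LinearMap.mul k A) θ ∘ₗ D.mkInd (D.Ind A) c ∘ₗ D.inclC =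
        TensorProduct.curry θ c := LinearMap.ext fun d => one_mul _
    rw [key, ← h.2]
    exact (D.colinearExt_inclCC θ c d).symm⟩

/-- The isomorphism `V₁ ≅ V₃`, `ν ↦ (ε ⊗ A) ν(- ⊗ - ⊗ 1)`. -/
def equivV₁V₃ : D.V₁ ≃ₗ[k] D.V₃ :=
  submoduleEquiv (LinearMap.compRight k (D.indCounit A) ∘ₗ LinearMap.lcomp k (D.Ind A) D.inclCC)
    D.colinearExt
    (fun _ h => comp_inclCC_mem_V₃ h) (fun _ h => D.colinearExt_mem_V₁ h)
    -- With `ρ` for the coactions, colinearity turns `(C ⊗ (ε ⊗ A) ν) ρ` into `(C ⊗ (ε ⊗ A)) ρ ν`,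
    -- which is `ν` by the counit law.
    (fun ν h => LinearMap.ext fun x => by
      refine (congrArg (fun f => f.lTensor C (D.indCoact (D.Ind A) x))
        (ext₂_mul_of_mem_V₁ h)).trans ?_
      rw [LinearMap.lTensor_comp_apply, ← h.2.1]
      exact D.indCounit_lTensor_indCoact _)
    (fun θ _ => (congrArg (· ∘ₗ D.inclCC) (D.indCounit_colinearExt θ)).trans
      (D.ext₂_comp_inclCC _ one_mul θ))

theorem normalized₃_equivV₁V₃ (ν : D.V₁) :
    D.Normalized₃ (D.equivV₁V₃ ν).1 ↔ D.Normalized₁ ν.1 := by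
  constructor
  · intro h c a
    have hν : D.colinearExt (D.equivV₁V₃ ν).1 = ν.1 :=
      congrArg Subtype.val (D.equivV₁V₃.symm_apply_apply ν)
    generalize (D.equivV₁V₃ ν).1 = θ at h hν
    let ρ : D.Ind A →ₗ[k] D.Ind (D.Ind A) := D.indCoact A
    -- Normalization of `θ` at `c`, extended left linearly from `c ⊗ 1` to `c ⊗ a`.
    have key : D.ext₂ (LinearMap.mul k A) θ ∘ₗ ρ = D.indCounit A :=
      D.ind_ext fun c a => by
        rw [LinearMap.comp_apply, tmul_eq_leftMul]
        refine (congrArg (D.ext₂ (LinearMap.mul k A) θ)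
          (D.indCoact_leftMul a (D.inclC c))).trans ?_
        rw [← inclCC_comul]
        refine (D.ext₂_lTensor_leftMul (L := LinearMap.mul k A) mul_assoc θ a _).trans ?_
        refine (congrArg _ (LinearMap.congr_fun (D.ext₂_comp_inclCC _ one_mul θ) _)).trans ?_
        rw [h, indCounit_leftMul, inclC_apply, indCounit_tmul, Algebra.algebraMap_eq_smul_one,
          LinearMap.mul_apply']
    rw [← hν]
    -- Coassociativity places the second coaction under `C ⊗ -`, where `key` collapses it to `ε ⊗
    -- A`.
    refine (congrArg ((D.ext₂ (LinearMap.mul k A) θ).lTensor C)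
      (D.indCoact_coassoc (D.tmul c a))).trans ?_
    refine (LinearMap.lTensor_comp_apply C (D.ext₂ (LinearMap.mul k A) θ) ρ _).symm.trans ?_
    rw [key]
    exact D.indCounit_lTensor_indCoact _
  · intro h c
    refine (congrArg (fun z => D.indCounit A (ν.1 z)) (D.inclCC_comul c)).trans ?_
    refine (congrArg (D.indCounit A) (h c 1)).trans ?_
    rw [indCounit_tmul, Algebra.algebraMap_eq_smul_one]

/-! ### `V₅` and `V'₅` -/

theorem smashToKoppinen_smash_apply (a : A) (f : ConvDual k C) (c : C) :
    D.smashToKoppinen (D.smash a f) c = f c • a := rfl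

/-- The image under `i` of the factorization `a # c* = (1 # c*)(a # ε)`. It separates linearity over
`A` from linearity over the elements `1 # c*`. -/
theorem smashToKoppinen_smash (a : A) (f : ConvDual k C) : D.smashToKoppinen (D.smash a f) =
    D.smashToKoppinen (D.smash 1 f) * D.koppinenA a :=
  DFunLike.ext _ _ fun c => by
    rw [mul_koppinenA_apply, smashToKoppinen_smash_apply, smashToKoppinen_smash_apply,
      smul_mul_assoc, one_mul]

/-- In `g • i(1 # f)` the second factor has scalar values, so the product contracts the `C`-leg of
`spread g` with `f`. The right side of the colinearity condition enters through this formula. -/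
theorem mul_smashToKoppinen_smash_one (g : D.Koppinen) (f : ConvDual k C) (d : C) :
    (g * D.smashToKoppinen (D.smash 1 f)) d =
      TensorProduct.lid k A (f.ofConv.rTensor A (D.spread (D.toHom g) d)) := by
  change D.contract (D.toHom (D.smashToKoppinen (D.smash 1 f))) (D.spread (D.toHom g) d) = _
  generalize D.spread (D.toHom g) d = z
  induction z with
  | zero => simp only [map_zero]
  | add s s' hs hs' => simp only [map_add, hs, hs']
  | tmul c a =>
    change a * (f c • 1) = f c • a
    rw [mul_smul_comm, mul_one]

theorem lid_rTensor_lTensor {X Y Z : Type*} [AddCommGroup X] [Module k X] [AddCommGroup Y]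
    [Module k Y] [AddCommGroup Z] [Module k Z] (f : X →ₗ[k] k) (g : Y →ₗ[k] Z) (z : X ⊗[k] Y) :
    TensorProduct.lid k Z (f.rTensor Z (g.lTensor X z)) =
      g (TensorProduct.lid k Y (f.rTensor Y z)) := by
  induction z with
  | zero => simp
  | add s s' hs hs' => simp only [map_add, hs, hs']
  | tmul x y => simp

theorem smashAct_one_inclC (f : ConvDual k C) (c : C) :
    D.smashAct (D.indCoact A) (D.smash 1 f) (D.inclC c) = D.inclC
      (TensorProduct.lid k C (f.ofConv.rTensor C (Coalgebra.comul (R := k) c))) := by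
  rw [smashAct_smash, op_one, one_smul, inclC_apply, indCoact_tmul]
  exact lid_rTensor_lTensor f.ofConv D.inclC _

theorem smashAct_smash_eq {M : Type*} [AddCommGroup M] [Module k M] [Module Aᵐᵒᵖ M]
    [IsScalarTower k Aᵐᵒᵖ M] (ρ : M →ₗ[k] C ⊗[k] M) (a : A) (f : ConvDual k C) (m : M) :
    D.smashAct ρ (D.smash a f) m = op a • D.smashAct ρ (D.smash 1 f) m := by
  rw [smashAct_smash, smashAct_smash, op_one, one_smul]

theorem smashAct_inclA {M : Type*} [AddCommGroup M] [Module k M] [Module Aᵐᵒᵖ M]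
    [IsScalarTower k Aᵐᵒᵖ M] {ρ : M →ₗ[k] C ⊗[k] M} (hρ : IsLeftCoaction k C M ρ) (a : A)
    (m : M) : D.smashAct ρ (D.smash a 1) m = op a • m := by
  rw [smashAct_smash]
  exact congrArg (op a • ·) (hρ.counit m)

theorem smashAct_leftMul (s : D.Smash) (b : A) (x : D.Ind A) :
    D.smashAct (D.indCoact A) s (D.leftMul b x) = D.leftMul b (D.smashAct (D.indCoact A) s x) := by
  rw [smashAct_eq_tri, smashAct_eq_tri]
  exact D.tri_leftMul _ b x

/-- `1 # f` acts on `c ⊗ 1` by contracting the first leg of `Δ(c)`, and on the target it contracts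
the `C`-leg of `spread`. Linearity evaluated at `d` is therefore the colinearity identity after `f ⊗
A`. -/
theorem map_smashAct_one_iff (ψ : D.Ind A →ₗ[k] D.Koppinen) (f : ConvDual k C) (c : C) :
    ψ (D.smashAct (D.indCoact A) (D.smash 1 f) (D.inclC c)) =
      ψ (D.inclC c) * D.smashToKoppinen (D.smash 1 f) ↔ ∀ d,
    TensorProduct.lid k A (f.ofConv.rTensor A
      (((D.toHom.toLinearMap ∘ₗ ψ ∘ₗ D.inclC).flip d).lTensor C (Coalgebra.comul (R := k) c))) =
    TensorProduct.lid k A (f.ofConv.rTensor A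
      (D.spread ((D.toHom.toLinearMap ∘ₗ ψ ∘ₗ D.inclC) c) d)) := by
  rw [DFunLike.ext_iff]
  refine forall_congr' fun d => ?_
  rw [smashAct_one_inclC, mul_smashToKoppinen_smash_one, lid_rTensor_lTensor]
  rfl

theorem V₅_le_V'₅ : D.V₅ ≤ D.V'₅ := fun ψ h => ⟨h.1, fun s x => by
  -- Left linearity of `ψ` reduces this to `c ⊗ 1`, where it is a contraction of the colinearity
  -- identity.
  have h1 : ∀ f : ConvDual k C, ψ ∘ₗ D.smashAct (D.indCoact A) (D.smash 1 f) =
      LinearMap.mulRight k (D.smashToKoppinen (D.smash 1 f)) ∘ₗ ψ := fun f =>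
    D.ind_ext fun c a => by
      rw [LinearMap.comp_apply, LinearMap.comp_apply, tmul_eq_leftMul,
        smashAct_leftMul, h.1, h.1, LinearMap.mulRight_apply, mul_assoc]
      congr 1
      exact (D.map_smashAct_one_iff ψ f c).2 fun d => by rw [h.2.2]
  -- Both sides are linear in the element of `A # C*`, which may thus be taken to be `a # f`; it
  -- acts as `1 # f` followed by `a`.
  have h2 : ψ.compRight k ∘ₗ D.smashAct (D.indCoact A) =
      LinearMap.lcomp k D.Koppinen ψ ∘ₗ (LinearMap.mul k D.Koppinen).flip ∘ₗ
        D.smashToKoppinen.toLinearMap :=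
    TensorProduct.ext' (M := A) (N := ConvDual k C) fun a f => LinearMap.ext fun x => by
      change ψ (D.smashAct (D.indCoact A) (D.smash a f) x) =
        ψ x * D.smashToKoppinen (D.smash a f)
      rw [smashAct_smash_eq, h.2.1, smashToKoppinen_smash, ← mul_assoc]
      exact congrArg (· * _) (LinearMap.congr_fun (h1 f) x)
  exact LinearMap.congr_fun (LinearMap.congr_fun h2 s) x⟩

/-- Right `A`-linearity is linearity over the elements `a # ε`. Colinearity follows from all its
contractions with functionals, since these separate the elements of `C ⊗ A`. -/
theorem V'₅_eq_V₅ (hC : Module.Projective k C) : D.V'₅ = D.V₅ :=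
  le_antisymm (fun ψ h => ⟨h.1, fun a x => by
      rw [← D.smashAct_inclA (D.isDoiHopfCoaction_indCoact A).isLeftCoaction, h.2]
      rfl,
    fun c d => eq_of_forall_dual_rTensor hC fun f =>
      (D.map_smashAct_one_iff ψ (WithConv.toConv f) c).1 (h.2 _ _) d⟩) D.V₅_le_V'₅

/-! ### Natural transformations `P G ⟶ T` -/

/-- An object of `ModuleCat` over `(A # C*)ᵐᵒᵖ` receives its `k`-structure through the algebra map.
Its agreement with the given structure on `M` is needed to regard the components of `φ` as
`k`-linear. -/
theorem op_algebraMap_smul (M : D.DoiHopfModule) (r : k) (m : M.carrier) :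
    op (algebraMap k D.Smash r) • m = r • m := by
  rw [op_smul_eq_smashAct, smashAct_eq_tri, AlgHom.commutes, Algebra.algebraMap_eq_smul_one]
  refine (LinearMap.congr_fun (D.tri_smul M.carrier M.coact r D.kone) m).trans ?_
  exact congrArg (r • ·) (tri_kone M.isDoiHopfCoaction m)

theorem actK_algebraMap (N : Type*) [AddCommGroup N] [Module k N] [Module Aᵐᵒᵖ N] (r : k)
    (x : D.TensorK N) : D.actK N (algebraMap k D.Koppinen r) x = r • x :=
  D.hom_congr_K N (D.actK N (algebraMap k D.Koppinen r)).toAddMonoidHom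
    (DistribSMul.toAddMonoidHom (D.TensorK N) r) (fun n f => by
      change D.mkK N (n ⊗ₜ (f * algebraMap k D.Koppinen r)) = r • D.mkK N (n ⊗ₜ f)
      rw [Algebra.algebraMap_eq_smul_one, mul_smul_comm, mul_one, tmul_smul, map_smul]) x

/-- The identity of `N ⊗_A #(C, A)`, with the `k`-module structure of `T(N)` on the source. -/
def ofT (N : ModuleCat.{u} Aᵐᵒᵖ) : D.T.obj N →ₗ[k] D.TensorK N where
  toFun x := x
  map_add' _ _ := rfl
  map_smul' r x := by
    change D.actK N (D.smashToKoppinen (algebraMap k D.Smash r)) x = _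
    rw [AlgHom.commutes]
    exact D.actK_algebraMap N r x

/-- The component of a natural transformation `P G ⟶ T` as a `k`-linear map. -/
def appLin (φ : D.V') (N : ModuleCat.{u} Aᵐᵒᵖ) : D.Ind N →ₗ[k] D.TensorK N where
  toFun x := (φ.app N).hom x
  map_add' := map_add (φ.app N).hom
  map_smul' r x := by
    have h := (φ.app N).hom.map_smul (op (algebraMap k D.Smash r)) x
    refine ((congrArg (φ.app N).hom (D.op_algebraMap_smul (D.G.obj N) r x)).symm.trans h).trans ?_
    exact (D.ofT N).map_smul r ((φ.app N).hom x)

theorem appLin_smashAct (φ : D.V') (N : ModuleCat.{u} Aᵐᵒᵖ) (s : D.Smash) (x : D.Ind N) :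
    D.appLin φ N (D.smashAct (D.indCoact N) s x) =
      D.actK N (D.smashToKoppinen s) (D.appLin φ N x) :=
  (φ.app N).hom.map_smul (op s) x

theorem appLin_indMap (φ : D.V') {N L : ModuleCat.{u} Aᵐᵒᵖ} (f : N ⟶ L) (x : D.Ind N) :
    D.appLin φ L (D.indMap f.hom x) = D.mapK f.hom (D.appLin φ N x) :=
  LinearMap.congr_fun (congrArg ModuleCat.Hom.hom (φ.naturality f)) x

theorem appLin_add (φ φ' : D.V') (N : ModuleCat.{u} Aᵐᵒᵖ) :
    D.appLin (φ + φ') N = D.appLin φ N + D.appLin φ' N := rfl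

theorem appLin_smul (r : k) (φ : D.V') (N : ModuleCat.{u} Aᵐᵒᵖ) :
    D.appLin (r • φ) N = r • D.appLin φ N :=
  LinearMap.ext fun x => (D.ofT N).map_smul r ((φ.app N).hom x)

variable {D} in
theorem appLin_injective {φ φ' : D.V'} (h : ∀ N, D.appLin φ N = D.appLin φ' N) : φ = φ' :=
  NatTrans.ext (funext fun N => ModuleCat.hom_ext (LinearMap.ext fun x =>
    LinearMap.congr_fun (h N) x))

/-! ### From bimodule maps to natural transformations. -/

section Orbit

variable {N : Type u} [AddCommGroup N] [Module k N] [Module Aᵐᵒᵖ N] [IsScalarTower k Aᵐᵒᵖ N]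

/-- The right `A`-linear map `a ↦ n a`. -/
def orbit (n : N) : A →ₗ[Aᵐᵒᵖ] N where
  toFun a := op a • n
  map_add' a b := by rw [MulOpposite.op_add, add_smul]
  map_smul' a b := by rw [MulOpposite.smul_eq_mul_unop, op_mul, op_unop, mul_smul]; rfl

theorem orbit_apply (n : N) (a : A) : orbit n a = op a • n := rfl

theorem indMap_orbit_inclC (n : N) (c : C) :
    D.indMap (orbit n) (D.inclC c) = D.tmul c n := by
  rw [inclC_apply, indMap_tmul, orbit_apply, op_one, one_smul]

/-- The Doi-Hopf module `C ⊗ N`. -/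
def indModule (N : Type u) [AddCommGroup N] [Module k N] [Module Aᵐᵒᵖ N]
    [IsScalarTower k Aᵐᵒᵖ N] : D.DoiHopfModule where
  carrier := D.Ind N
  coact := D.indCoact N
  isDoiHopfCoaction := D.isDoiHopfCoaction_indCoact N

/-- `indMap g` is a morphism of Doi-Hopf modules, and the action of `A # C*` is `tri` along `i`,
which such morphisms preserve. -/
theorem smashAct_indMap (g : A →ₗ[Aᵐᵒᵖ] N) (s : D.Smash) (x : D.Ind A) :
    D.smashAct (D.indCoact N) s (D.indMap g x) =
      D.indMap g (D.smashAct (D.indCoact A) s x) := by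
  rw [smashAct_eq_tri, smashAct_eq_tri]
  let f : D.indModule A ⟶ D.indModule N :=
    { hom := D.indMap g
      colinear := indCoact_map (g.restrictScalars k) }
  exact (DoiHopfModule.hom_tri f (D.smashToKoppinen s) x).symm

variable (N) in
/-- The map `c ⊗ n ↦ n ⊗ ψ(c ⊗ 1)`. -/
def bimodLin (ψ : D.Ind A →ₗ[k] D.Koppinen) : D.Ind N →ₗ[k] D.TensorK N :=
  (TensorProduct.lift (((TensorProduct.mk k N D.Koppinen).compr₂ (D.mkK N)).flip ∘ₗ
    ψ ∘ₗ D.inclC) : C ⊗[k] N →ₗ[k] D.TensorK N)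

theorem bimodLin_tmul (ψ : D.Ind A →ₗ[k] D.Koppinen) (c : C) (n : N) :
    D.bimodLin N ψ (D.tmul c n) = D.tmulK n (ψ (D.inclC c)) := rfl

/-- At `c ⊗ a` the claim is `n a ⊗ ψ(c ⊗ 1) = n ⊗ ψ(c ⊗ a)`: `a` crosses the tensor product over `A`
and is absorbed by left linearity of `ψ`. -/
theorem bimodLin_indMap_orbit {ψ : D.Ind A →ₗ[k] D.Koppinen} (h : ψ ∈ D.V'₅) (n : N)
    (x : D.Ind A) : D.bimodLin N ψ (D.indMap (orbit n) x) = D.tmulK n (ψ x) :=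
  LinearMap.congr_fun (D.ind_ext
    (f := D.bimodLin N ψ ∘ₗ (D.indMap (orbit n)).restrictScalars k)
    (g := D.mkK N ∘ₗ TensorProduct.mk k N D.Koppinen n ∘ₗ ψ) fun c a => by
      change D.bimodLin N ψ (D.indMap (orbit n) (D.tmul c a)) = D.tmulK n (ψ (D.tmul c a))
      rw [indMap_tmul, bimodLin_tmul, orbit_apply, tmulK_balanced, tmul_eq_leftMul, h.1]) x

theorem bimodLin_smashAct {ψ : D.Ind A →ₗ[k] D.Koppinen} (h : ψ ∈ D.V'₅) (s : D.Smash)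
    (x : D.Ind N) : D.bimodLin N ψ (D.smashAct (D.indCoact N) s x) =
      D.actK N (D.smashToKoppinen s) (D.bimodLin N ψ x) :=
  LinearMap.congr_fun (D.ind_ext (f := D.bimodLin N ψ ∘ₗ D.smashAct (D.indCoact N) s)
    (g := D.actK N (D.smashToKoppinen s) ∘ₗ D.bimodLin N ψ) fun c n => by
      -- `c ⊗ n` is the image of `c ⊗ 1` under `a ↦ n a`, so linearity of `ψ` at `c ⊗ 1` gives
      -- linearity on `C ⊗ N`.
      rw [LinearMap.comp_apply, LinearMap.comp_apply, ← indMap_orbit_inclC, smashAct_indMap,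
        bimodLin_indMap_orbit D h, bimodLin_indMap_orbit D h, actK_tmulK, h.2]) x

theorem bimodLin_indMap {L : Type u} [AddCommGroup L] [Module k L] [Module Aᵐᵒᵖ L]
    [IsScalarTower k Aᵐᵒᵖ L] (ψ : D.Ind A →ₗ[k] D.Koppinen) (f : N →ₗ[Aᵐᵒᵖ] L) (x : D.Ind N) :
    D.bimodLin L ψ (D.indMap f x) = D.mapK f (D.bimodLin N ψ x) := by
  change C ⊗[k] N at x
  induction x with
  | zero =>
    exact (map_zero (D.bimodLin L ψ ∘ₗ (D.indMap f).restrictScalars k)).trans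
      (map_zero ((D.mapK f).toAddMonoidHom.comp (D.bimodLin N ψ).toAddMonoidHom)).symm
  | add s s' hs hs' =>
    exact (map_add (D.bimodLin L ψ ∘ₗ (D.indMap f).restrictScalars k) s s').trans
      ((congrArg₂ (· + ·) hs hs').trans
      (map_add ((D.mapK f).toAddMonoidHom.comp (D.bimodLin N ψ).toAddMonoidHom) s s').symm)
  | tmul c n => rfl

end Orbit

/-- The natural transformation `P G ⟶ T`, `c ⊗ n ↦ n ⊗ ψ(c ⊗ 1)`, of a bimodule map `ψ`. -/
def natOfBimod (ψ : D.V'₅) : D.V' where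
  app N := ModuleCat.ofHom (X := (D.G.obj N).carrier) (Y := D.T.obj N)
    { toFun := D.bimodLin N ψ.1
      map_add' := map_add (D.bimodLin N ψ.1)
      map_smul' s x := D.bimodLin_smashAct ψ.2 (unop s) x }
  naturality _ _ f := ModuleCat.hom_ext (LinearMap.ext fun x => D.bimodLin_indMap ψ.1 f.hom x)

theorem appLin_natOfBimod (ψ : D.V'₅) (N : ModuleCat.{u} Aᵐᵒᵖ) :
    D.appLin (D.natOfBimod ψ) N = D.bimodLin N ψ.1 := rfl

/-! ### From natural transformations to bimodule maps. -/

/-- The identity from the regular right `A`-module to `A`. -/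
def ofRegular : D.regular →ₗ[k] A where
  toFun a := a
  map_add' _ _ := rfl
  -- On the regular module `k` acts through `Aᵐᵒᵖ`, that is, by right multiplication; the two
  -- structures agree because the image of `k` is central in `A`.
  map_smul' r := fun (a : A) => by
    change a * algebraMap k A r = r • a
    rw [Algebra.smul_def, Algebra.commutes]

/-- The isomorphism `A ⊗_A #(C, A) ≅ #(C, A)`, as a map. -/
def contractK : D.TensorK D.regular →ₗ[k] D.Koppinen :=
  D.liftK (TensorProduct.lift (D.leftActK ∘ₗ D.ofRegular)) (fun n a f =>
    D.leftActK_mul (D.ofRegular n) a f)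

theorem contractK_tmulK (a : A) (f : D.Koppinen) :
    D.contractK (D.tmulK (D.toRegular a) f) = D.koppinenA a * f := rfl

theorem contractK_actK (g : D.Koppinen) (z : D.TensorK D.regular) :
    D.contractK (D.actK D.regular g z) = D.contractK z * g :=
  D.hom_congr_K D.regular (D.contractK ∘ₗ D.actK D.regular g).toAddMonoidHom
    (LinearMap.mulRight k g ∘ₗ D.contractK).toAddMonoidHom
    (fun n f => (mul_assoc (D.koppinenA (D.ofRegular n)) f g).symm) z

theorem tmulK_contractK (z : D.TensorK D.regular) :
    D.tmulK (D.toRegular 1) (D.contractK z) = z :=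
  D.hom_congr_K D.regular
    ((D.mkK D.regular ∘ₗ TensorProduct.mk k D.regular D.Koppinen (D.toRegular 1)) ∘ₗ
      D.contractK).toAddMonoidHom (AddMonoidHom.id _)
    (fun n f => by
      change D.tmulK (D.toRegular 1) (D.koppinenA (D.ofRegular n) * f) = D.tmulK n f
      rw [← tmulK_balanced]
      exact congrArg (D.tmulK · f) (one_mul (D.ofRegular n))) z

/-- The map `c ⊗ a ↦ c ⊗ a` from `C ⊗ A` to `G(A)`. -/
def indToRegular : D.Ind A →ₗ[k] D.Ind D.regular :=
  (D.indMap (orbit (D.toRegular 1))).restrictScalars k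

theorem indToRegular_tmul (c : C) (a : A) :
    D.indToRegular (D.tmul c a) = D.tmul c (D.toRegular a) :=
  congrArg (D.tmul (M := D.regular) c) (one_mul a)

/-- The map `C ⊗ A → Hom(C, A)` that is `φ_A`, up to `A ⊗_A #(C, A) ≅ #(C, A)`. -/
def bimodOfNat : D.V' →ₗ[k] D.Ind A →ₗ[k] D.Koppinen where
  toFun φ := D.contractK ∘ₗ D.appLin φ D.regular ∘ₗ D.indToRegular
  map_add' φ φ' := by
    rw [appLin_add, LinearMap.add_comp, LinearMap.comp_add]
  map_smul' r φ := by
    rw [appLin_smul, LinearMap.smul_comp, LinearMap.comp_smul]; rfl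

/-- The Eilenberg-Watts step: naturality along `a ↦ n a` sends `1 ⊗ φ_A(x)` to `n ⊗ φ_A(x)`. Hence
`φ_A` determines `φ`. -/
theorem appLin_indMap_orbit (φ : D.V') (N : ModuleCat.{u} Aᵐᵒᵖ) (n : N) (x : D.Ind A) :
    D.appLin φ N (D.indMap (orbit n) x) = D.tmulK n (D.bimodOfNat φ x) := by
  let f : D.regular ⟶ N := ModuleCat.ofHom (orbit n)
  have h : D.indMap (orbit n) x = D.indMap f.hom (D.indToRegular x) :=
    LinearMap.congr_fun (D.ind_ext (f := (D.indMap (orbit n)).restrictScalars k)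
      (g := (D.indMap f.hom).restrictScalars k ∘ₗ D.indToRegular) fun c a =>
        (congrArg (D.indMap f.hom) (D.indToRegular_tmul c a)).symm) x
  rw [h, appLin_indMap, ← D.tmulK_contractK (D.appLin φ D.regular (D.indToRegular x)),
    mapK_tmulK]
  exact congrArg (D.tmulK · _) (one_smul Aᵐᵒᵖ n)

/-- Left multiplication by `a` is the orbit map of `a` in the regular module, so left linearity is
an instance of naturality. Right linearity is that of the component `φ_A`. -/
theorem bimodOfNat_mem (φ : D.V') : D.bimodOfNat φ ∈ D.V'₅ := by
  refine ⟨fun a x => ?_, fun s x => ?_⟩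
  · have h : D.indToRegular (D.leftMul a x) = D.indMap (orbit (D.toRegular a)) x :=
      LinearMap.congr_fun (D.ind_ext (f := D.indToRegular ∘ₗ D.leftMul a)
        (g := (D.indMap (orbit (D.toRegular a))).restrictScalars k) fun c b =>
          D.indToRegular_tmul c (a * b)) x
    change D.contractK (D.appLin φ D.regular (D.indToRegular (D.leftMul a x))) = _
    rw [h, appLin_indMap_orbit, contractK_tmulK]
  · change D.contractK (D.appLin φ D.regular (D.indMap (orbit (D.toRegular 1))
      (D.smashAct (D.indCoact A) s x))) = _
    rw [← smashAct_indMap, appLin_smashAct, contractK_actK]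
    rfl

/-- The isomorphism `V' ≅ V'₅`. -/
def equivV'V'₅ : D.V' ≃ₗ[k] D.V'₅ :=
  { D.bimodOfNat.codRestrict D.V'₅ D.bimodOfNat_mem with
    invFun := D.natOfBimod
    left_inv := fun φ => appLin_injective fun N => D.ind_ext fun c n => by
      rw [appLin_natOfBimod, bimodLin_tmul, ← indMap_orbit_inclC, appLin_indMap_orbit]
      rfl
    right_inv := fun ψ => Subtype.ext (LinearMap.ext fun x => by
      change D.contractK (D.bimodLin D.regular ψ.1 (D.indMap (orbit (D.toRegular 1)) x)) = ψ.1 x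
      rw [bimodLin_indMap_orbit D ψ.2, contractK_tmulK, map_one, one_mul]) }

theorem equivV'V'₅_symm_app (ψ : D.V'₅) (N : ModuleCat.{u} Aᵐᵒᵖ) (c : C) (n : N) :
    ((D.equivV'V'₅.symm ψ).app N).hom (D.tmul c n : D.Ind N) = D.tmulK n (ψ.1 (D.tmul c 1)) :=
  rfl

theorem app_regular_eq (φ : D.V') (c : C) (a : A) :
    (φ.app D.regular).hom (D.tmul c (D.toRegular a) : D.Ind D.regular) =
      D.tmulK (D.toRegular 1) ((D.equivV'V'₅ φ).1 (D.tmul c a)) := by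
  rw [← indToRegular_tmul]
  exact D.appLin_indMap_orbit φ D.regular (D.toRegular 1) (D.tmul c a)

/-! ### Relative splittings and normalized elements -/

/-- The map `c ↦ ∑ ψ(c₍₁₎ ⊗ 1)(c₍₂₎)`. -/
def diagEval (ψ : D.Ind A →ₗ[k] D.Koppinen) : C →ₗ[k] A :=
  TensorProduct.lift (D.toHom.toLinearMap ∘ₗ ψ ∘ₗ D.inclC) ∘ₗ Coalgebra.comul

theorem normalized₅_iff (ψ : D.Ind A →ₗ[k] D.Koppinen) :
    D.Normalized₅ ψ ↔ D.diagEval ψ = D.kone :=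
  (LinearMap.ext_iff (f := D.diagEval ψ) (g := D.kone)).symm

/-- The composite sends `m` to `∑ m₍₀₎ ψ(m₍₋₂₎ ⊗ 1)(m₍₋₁₎)`. Coassociativity lets both legs come
from the comultiplication of one element of `C`, on which `ψ` evaluates to `diagEval ψ`. -/
theorem chiLin_bimodLin (M : D.DoiHopfModule) (ψ : D.Ind A →ₗ[k] D.Koppinen) (m : M.carrier) :
    D.chiLin M (D.bimodLin (D.F.obj M) ψ ((D.toF M).lTensor C (M.coact m))) =
      D.tri M.coact (D.diagEval ψ) m := by
  -- `W` sends `c ⊗ d ⊗ z` to `z ψ(c ⊗ 1)(d)`.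
  let W : C ⊗[k] (C ⊗[k] M.carrier) →ₗ[k] M.carrier :=
    TensorProduct.lift (LinearMap.mk₂ k (fun (c : C) (y : C ⊗[k] M.carrier) =>
      TensorProduct.lift (rightAct k A M.carrier ∘ₗ D.toHom (ψ (D.inclC c))) y)
      (fun c c' y => by
        rw [map_add, map_add, map_add, LinearMap.comp_add]
        induction y with
        | zero => simp only [map_zero, add_zero]
        | add s s' hs hs' => simp only [map_add, hs, hs']; abel
        | tmul d z => rfl)
      (fun r c y => by
        rw [map_smul, map_smul, map_smul, LinearMap.comp_smul]
        induction y with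
        | zero => simp only [map_zero, smul_zero]
        | add s s' hs hs' => simp only [map_add, hs, hs', smul_add]
        | tmul d z => rfl)
      (fun c y y' => map_add _ _ _) (fun r c y => map_smul _ _ _))
  have h1 : ∀ t : C ⊗[k] M.carrier,
      D.chiLin M (D.bimodLin (D.F.obj M) ψ ((D.toF M).lTensor C t)) =
        W (M.coact.lTensor C t) := fun t =>
    LinearMap.congr_fun (TensorProduct.ext'
      (g := D.chiLin M ∘ₗ D.bimodLin (D.F.obj M) ψ ∘ₗ
        ((D.toF M).lTensor C : C ⊗[k] M.carrier →ₗ[k] C ⊗[k] D.F.obj M))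
      (h := W ∘ₗ M.coact.lTensor C) fun c z => rfl) t
  rw [h1, ← M.isDoiHopfCoaction.isLeftCoaction.coassoc, tri, LinearMap.comp_apply]
  generalize M.coact m = t
  induction t with
  | zero => simp only [map_zero]
  | add s s' hs hs' => simp only [map_add, hs, hs']
  | tmul c z =>
    rw [LinearMap.rTensor_tmul, TensorProduct.lift.tmul, diagEval, LinearMap.comp_apply,
      LinearMap.comp_apply]
    generalize Coalgebra.comul (R := k) c = v
    induction v with
    | zero => simp only [map_zero, zero_tmul, LinearMap.zero_apply]
    | add s s' hs hs' => simp only [map_add, add_tmul, LinearMap.add_apply, hs, hs']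
    | tmul x y => rfl

/-- The splitting condition says that `diagEval ψ` acts as the identity on every Doi-Hopf module;
the unit `kone` does so, and the module `C ⊗ A` shows that nothing else does. -/
theorem splitsUnit_iff (φ : D.V') : D.SplitsUnit φ ↔ D.Normalized₅ (D.equivV'V'₅ φ).1 := by
  obtain ⟨ψ, rfl⟩ := D.equivV'V'₅.symm.surjective φ
  rw [LinearEquiv.apply_symm_apply, normalized₅_iff]
  have key : D.SplitsUnit (D.equivV'V'₅.symm ψ) ↔
      ∀ (M : D.DoiHopfModule) (m : M.carrier), D.tri M.coact (D.diagEval ψ.1) m = m := by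
    refine forall_congr' fun M => ?_
    rw [ModuleCat.hom_ext_iff, LinearMap.ext_iff]
    exact forall_congr' fun m => Eq.congr_left (D.chiLin_bimodLin M ψ.1 m)
  rw [key]
  refine ⟨fun h => LinearMap.ext fun c => ?_, fun h M m => ?_⟩
  -- The test element is `c ⊗ 1` in `C ⊗ A`: an element `f` of `#(C, A)` sends it to `spread f c`,
  -- from which `ε ⊗ A` recovers `f c`.
  · have h1 := D.indCounit_spread (D.diagEval ψ.1) c
    rw [spread_eq] at h1
    refine h1.symm.trans ((congrArg (D.indCounit A) (h (D.indModule A) (D.tmul c 1))).trans ?_)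
    rw [indCounit_tmul, ← Algebra.algebraMap_eq_smul_one]
    rfl
  · rw [h]
    exact tri_kone M.isDoiHopfCoaction m

/-! ### Assembly of the isomorphisms and the separability criteria. -/

theorem isSeparableRelative_iff {X : Type*} [AddCommGroup X] [Module k X] {p : Submodule k X}
    {Normalized : X → Prop}
    (h : ∃ e : D.V' ≃ₗ[k] p, ∀ φ : D.V', D.SplitsUnit φ ↔ Normalized (e φ).1) :
    IsSeparableRelative D.adj D.P D.T D.chi ↔ ∃ x ∈ p, Normalized x := by
  obtain ⟨e, he⟩ := h
  refine ⟨fun ⟨φ, hφ⟩ => ⟨_, (e φ).2, (he φ).1 hφ⟩, fun ⟨x, hx, h⟩ => ⟨e.symm ⟨x, hx⟩, ?_⟩⟩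
  refine (he _).2 ?_
  rwa [e.apply_symm_apply]

theorem exists_equiv_V₅ (hC : Module.Projective k C) :
    ∃ e : D.V' ≃ₗ[k] D.V₅, ∀ φ : D.V', D.SplitsUnit φ ↔ D.Normalized₅ (e φ).1 :=
  ⟨D.equivV'V'₅ ≪≫ₗ LinearEquiv.ofEq _ _ (D.V'₅_eq_V₅ hC), D.splitsUnit_iff⟩

theorem exists_equiv_V₄ (hC : Module.Projective k C) :
    ∃ e : D.V' ≃ₗ[k] D.V₄, ∀ φ : D.V', D.SplitsUnit φ ↔ D.Normalized₄ (e φ).1 := by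
  obtain ⟨e, he⟩ := D.exists_equiv_V₅ hC
  exact ⟨e ≪≫ₗ D.equivV₅V₄, fun φ => (he φ).trans (D.normalized₄_equivV₅V₄ _).symm⟩

theorem exists_equiv_V₃ (hC : Module.Projective k C) :
    ∃ e : D.V' ≃ₗ[k] D.V₃, ∀ φ : D.V', D.SplitsUnit φ ↔ D.Normalized₃ (e φ).1 := by
  obtain ⟨e, he⟩ := D.exists_equiv_V₄ hC
  refine ⟨e ≪≫ₗ D.equivV₃V₄.symm, fun φ => ?_⟩
  rw [he, ← normalized₄_equivV₃V₄, LinearEquiv.trans_apply, LinearEquiv.apply_symm_apply]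

theorem exists_equiv_V₁ (hC : Module.Projective k C) :
    ∃ e : D.V' ≃ₗ[k] D.V₁, ∀ φ : D.V', D.SplitsUnit φ ↔ D.Normalized₁ (e φ).1 := by
  obtain ⟨e, he⟩ := D.exists_equiv_V₃ hC
  refine ⟨e ≪≫ₗ D.equivV₁V₃.symm, fun φ => ?_⟩
  rw [he, ← normalized₃_equivV₁V₃, LinearEquiv.trans_apply, LinearEquiv.apply_symm_apply]

theorem exists_equiv_V₂ (hC : Module.Projective k C) :
    ∃ e : D.V' ≃ₗ[k] D.V₂, ∀ φ : D.V', D.SplitsUnit φ ↔ D.Normalized₂ (e φ).1 := by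
  obtain ⟨e, he⟩ := D.exists_equiv_V₁ hC
  exact ⟨e ≪≫ₗ D.equivV₁V₂, fun φ => (he φ).trans (D.normalized₂_equivV₁V₂ _).symm⟩

end DoiHopfDatum

end DoiHopf

end

theorem theorem2p3p1 {k : Type u₁} {H : Type u₂} {A C : Type u} [CommRing k] [Ring H]
    [Bialgebra k H] [Ring A] [Algebra k A] [AddCommGroup C] [Module k C] [Coalgebra k C]
    [Module Hᵐᵒᵖ C] [IsScalarTower k Hᵐᵒᵖ C] (D : DoiHopf.DoiHopfDatum k H A C) :
    (∃ e : D.V' ≃ₗ[k] D.V'₅,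
      (∀ (ψ : D.V'₅) (N : ModuleCat.{u} Aᵐᵒᵖ) (c : C) (n : N),
        ((e.symm ψ).app N).hom (D.tmul c n : D.Ind N) = D.tmulK n (ψ.1 (D.tmul c 1))) ∧
      (∀ (φ : D.V') (c : C) (a : A),
        (φ.app D.regular).hom (D.tmul c (D.toRegular a) : D.Ind D.regular) =
          D.tmulK (D.toRegular 1) ((e φ).1 (D.tmul c a)))) ∧
    (Module.Projective k C →
      ((∃ e : D.V' ≃ₗ[k] D.V₁, ∀ φ : D.V', D.SplitsUnit φ ↔ D.Normalized₁ (e φ).1) ∧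
        (∃ e : D.V' ≃ₗ[k] D.V₂, ∀ φ : D.V', D.SplitsUnit φ ↔ D.Normalized₂ (e φ).1) ∧
        (∃ e : D.V' ≃ₗ[k] D.V₃, ∀ φ : D.V', D.SplitsUnit φ ↔ D.Normalized₃ (e φ).1) ∧
        (∃ e : D.V' ≃ₗ[k] D.V₄, ∀ φ : D.V', D.SplitsUnit φ ↔ D.Normalized₄ (e φ).1) ∧
        (∃ e : D.V' ≃ₗ[k] D.V₅, ∀ φ : D.V', D.SplitsUnit φ ↔ D.Normalized₅ (e φ).1)) ∧
      (DoiHopf.IsSeparableRelative D.adj D.P D.T D.chi ↔ ∃ ν ∈ D.V₁, D.Normalized₁ ν) ∧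
      (DoiHopf.IsSeparableRelative D.adj D.P D.T D.chi ↔ ∃ l ∈ D.V₂, D.Normalized₂ l) ∧
      (DoiHopf.IsSeparableRelative D.adj D.P D.T D.chi ↔ ∃ θ ∈ D.V₃, D.Normalized₃ θ) ∧
      (DoiHopf.IsSeparableRelative D.adj D.P D.T D.chi ↔ ∃ γ ∈ D.V₄, D.Normalized₄ γ) ∧
      (DoiHopf.IsSeparableRelative D.adj D.P D.T D.chi ↔ ∃ ψ ∈ D.V₅, D.Normalized₅ ψ)) :=
  ⟨⟨D.equivV'V'₅, D.equivV'V'₅_symm_app, D.app_regular_eq⟩, fun hC =>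
    ⟨⟨D.exists_equiv_V₁ hC, D.exists_equiv_V₂ hC, D.exists_equiv_V₃ hC, D.exists_equiv_V₄ hC,
      D.exists_equiv_V₅ hC⟩,
    D.isSeparableRelative_iff (D.exists_equiv_V₁ hC),
    D.isSeparableRelative_iff (D.exists_equiv_V₂ hC),
    D.isSeparableRelative_iff (D.exists_equiv_V₃ hC),
    D.isSeparableRelative_iff (D.exists_equiv_V₄ hC),
    D.isSeparableRelative_iff (D.exists_equiv_V₅ hC)⟩⟩
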